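/- Let $\mathcal W$ be the set of continuous nondecreasing $\omega:[0,\infty)\to[0,\infty)$ with $\omega(0)=0$, $\omega(x+y)\le\omega(x)+\omega(y)$, $\int_1^\infty \omega(t)t^{-2}\,dt<\infty$ and $\omega(t)/\log(1+t)\to\infty$ as $t\to\infty$; write $\omega_1\ll\omega_2$ if $\omega_1(t)=o(\omega_2(t))$ as $t\to\infty$. Let $n\ge1$, $\Omega\subseteq\mathbb R^n$ open, $\omega\in\mathcal W$. Put $\|f\|^{\tau}_{l}=\int|\hat f(\xi)|e^{l\tau(|\xi|)}d\xi$. Let $\mathcal D^{\{\omega\}}(\Omega)$ be the space of $f\in C_c^\infty(\Omega)$ with $\|f\|^\omega_l<\infty$ for some $l>0$, let $\mathcal D'^{\{\omega\}}(\Omega)$ be its dual (the linear functionals $T$ such that for all compact $K\subset\Omega$ and $l>0$ there is $C$ with $|T(f)|\le C\|f\|_l^\omega$ for all $f\in\mathcal D^{\{\omega\}}(\Omega)$ supported in $K$), and let $\mathcal E^{\{\omega\}}(\Omega)$ be the space of $f\in C^\infty(\Omega)$ with $\chi f\in\mathcal D^{\{\omega\}}(\Omega)$ for all $\chi\in\mathcal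 D^{\{\omega\}}(\Omega)$. For $K\subset\Omega$ compact and $f\in\mathcal E^{\{\omega\}}(\Omega)$ let $\|f\|^{\tau}_{K,l}=\inf\|\chi f\|^{\tau}_{l}$ over $\chi\in\mathcal D^{\{\omega\}}(\Omega)$ with $\chi=1$ on $K$. A net $(g_\varepsilon)_{\varepsilon\in(0,1)}$ in $\mathcal E^{\{\omega\}}(\Omega)$ is *moderate* if $\forall K\,\forall k>0\,\exists h>0:\ \|g_\varepsilon\|^\omega_{K,h}=o(e^{k\omega(1/\varepsilon)})$ as $\varepsilon\to0$, and *negligible* if $\forall K\,\exists k,h>0:\ \|g_\varepsilon\|^\omega_{K,h}=o(e^{-k\omega(1/\varepsilon)})$; $\mathcal G^{\{\omega\}}(\Omega)$ is the factor space of moderate by negligible nets. A class is *regular* (belongs to $\mathcal G^{\{\omega\},\infty}(\Omega)$) if it has a moderate representative with $\forall K\,\exists h>0\,\forall k>0:\ \|g_\varepsilon\|^\omega_{K,h}=o(e^{k\omega(1/\varepsilon)})$; it is regular *in the projective presentation* if it has a moderate representative with $\forall K\,\exists\omega_1\ll\omega\,\forall\omega_2\ll\omega:\ \|g_\varepsilon\|^{\omega_2}_{K,1}=o(e^{\omega_1(1/\varepsilon)})$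 (all weights in $\mathcal W$). $T\in\mathcal D'^{\{\omega\}}(\Omega)$ is *strongly associated* to $[(g_\varepsilon)]$ if for every representative and every compact $K\subset\Omega$ there is $\omega_b\in\mathcal W$, $\omega_b\ll\omega$, such that $\langle g_\varepsilon-T,\rho\rangle=o(e^{-\omega_b(1/\varepsilon)})$ for all $\rho\in\mathcal D^{\{\omega\}}(\Omega)$ supported in $K$. $T$ is *irregular* if it is not given by integration against an element of $\mathcal E^{\{\omega\}}(\Omega)$. **Proposition.** Let $\Omega$ be nonempty and $a\in\Omega$. There is a regular $g\in\mathcal G^{\{\omega\},\infty}(\Omega)$ strongly associated to an irregular $T\in\mathcal D'^{\{\omega\}}(\Omega)$. More precisely, the Dirac delta $\delta_a$ at $a$ is irregular; there exist Schwartz functions $\varphi$ on $\mathbb R^n$ whose Fourier transform has compact support and equals $1$ near $0$, and there exist $\omega_1\in\mathcal W$ with $\omega_1\ll\omega$; and for every such $\varphi$ and $\omega_1$, there is a map $\eta:(0,1)\to(0,\infty)$ with $\omega_1(1/\varepsilon)=\omega(1/\eta(\varepsilon))$ for all $\varepsilon$, and for every such $\eta$ the net $g_\varepsilon(x)=\varphi_{\eta(\varepsilon)}(x-a)$,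 where $\varphi_\eta(x)=\eta^{-n}\varphi(x/\eta)$, is moderate, and its class is regular (in both presentations) and strongly associated to $\delta_a$. (For $\Omega=\mathbb R^n$, $a=0$ this is the net $\varphi_{\eta(\varepsilon)}$ and $\delta$.) -/

import Mathlib

open MeasureTheory Filter Topology Asymptotics
open scoped ENNReal NNReal FourierTransform

noncomputable section

namespace Roumieu

/-- The Euclidean space `ℝⁿ`. -/
abbrev Rn (n : ℕ) := EuclideanSpace ℝ (Fin n)

/-- The class `𝒲` of weight functions on `[0, ∞)` (values at negative reals are irrelevant).
Nonnegativity follows from `map_zero` and `mono`. -/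
structure Weight where
  toFun : ℝ → ℝ
  cont : ContinuousOn toFun (Set.Ici 0)
  mono : MonotoneOn toFun (Set.Ici 0)
  map_zero : toFun 0 = 0
  subadd : ∀ x y, 0 ≤ x → 0 ≤ y → toFun (x + y) ≤ toFun x + toFun y
  integrable : IntegrableOn (fun t => toFun t / t ^ 2) (Set.Ioi 1)
  log_little : Tendsto (fun t => toFun t / Real.log (1 + t)) atTop atTop

instance : CoeFun Weight (fun _ => ℝ → ℝ) := ⟨Weight.toFun⟩

theorem Weight.nonneg (ω : Weight) {t : ℝ} (ht : 0 ≤ t) : 0 ≤ ω t := by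
  have h := ω.mono (Set.mem_Ici.2 le_rfl) (Set.mem_Ici.2 ht) ht
  rwa [ω.map_zero] at h

/-- The strong inequality `ω₁ << ω₂`, i.e. `ω₁(t) = o(ω₂(t))` as `t → ∞`. -/
def StrongLT (ω₁ ω₂ : Weight) : Prop := (fun t => ω₁ t) =o[atTop] (fun t => ω₂ t)

/-- The norm `‖f‖_l^ω = ∫ |f̂(ξ)| e^{l ω(|ξ|)} dξ`, with values in `[0, ∞]`.
The normalization of the Fourier transform (`e^{-2πi x·ξ}`) is immaterial: `ω(2π t) ≤ 7 ω(t)`. -/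
def wnorm {n : ℕ} (ω : Weight) (l : ℝ) (f : Rn n → ℂ) : ℝ≥0∞ :=
  ∫⁻ ξ, ‖𝓕 f ξ‖ₑ * ENNReal.ofReal (Real.exp (l * ω ‖ξ‖))

theorem wnorm_mono {n : ℕ} (ω : Weight) {l l' : ℝ} (h : l ≤ l') (f : Rn n → ℂ) :
    wnorm ω l f ≤ wnorm ω l' f := by
  refine lintegral_mono fun ξ => ?_
  have := ω.nonneg (norm_nonneg ξ)
  gcongr

theorem lintegral_fourier_le_wnorm {n : ℕ} (ω : Weight) {l : ℝ} (hl : 0 ≤ l) (f : Rn n → ℂ) :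
    ∫⁻ ξ, ‖𝓕 f ξ‖ₑ ≤ wnorm ω l f := by
  refine lintegral_mono fun ξ => ?_
  have h1 : (1 : ℝ≥0∞) ≤ ENNReal.ofReal (Real.exp (l * ω ‖ξ‖)) := by
    rw [ENNReal.one_le_ofReal]
    exact Real.one_le_exp (mul_nonneg hl (ω.nonneg (norm_nonneg ξ)))
  exact le_mul_of_one_le_right' h1

theorem fourier_measurable {n : ℕ} {f : Rn n → ℂ} (hf : Integrable f) :
    Continuous (𝓕 f) :=
  VectorFourier.fourierIntegral_continuous Real.continuous_fourierChar
    (by exact continuous_inner) hf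

theorem wnorm_add_le {n : ℕ} (ω : Weight) (l : ℝ) {f g : Rn n → ℂ}
    (hf : Integrable f) (hg : Integrable g) :
    wnorm ω l (f + g) ≤ wnorm ω l f + wnorm ω l g := by
  have hadd : 𝓕 (f + g) = 𝓕 f + 𝓕 g :=
    VectorFourier.fourierIntegral_add Real.continuous_fourierChar
      (by exact continuous_inner) hf hg
  have h1 : wnorm ω l (f + g) ≤ ∫⁻ ξ, (‖𝓕 f ξ‖ₑ * ENNReal.ofReal (Real.exp (l * ω ‖ξ‖))
      + ‖𝓕 g ξ‖ₑ * ENNReal.ofReal (Real.exp (l * ω ‖ξ‖))) := by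
    refine lintegral_mono fun ξ => ?_
    rw [← add_mul, hadd]
    gcongr
    exact enorm_add_le _ _
  refine h1.trans (le_of_eq ?_)
  have hw : Measurable fun ξ : Rn n => ENNReal.ofReal (Real.exp (l * ω ‖ξ‖)) := by
    have hc : Continuous fun ξ : Rn n => ω ‖ξ‖ :=
      ω.cont.comp_continuous continuous_norm fun ξ => norm_nonneg ξ
    exact (Real.continuous_exp.comp (continuous_const.mul hc)).measurable.ennreal_ofReal
  exact lintegral_add_left ((fourier_measurable hf).measurable.enorm.mul hw) _

theorem wnorm_smul {n : ℕ} (ω : Weight) (l : ℝ) (c : ℂ) (f : Rn n → ℂ) :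
    wnorm ω l (c • f) = ‖c‖ₑ * wnorm ω l f := by
  have hs : 𝓕 (c • f) = c • 𝓕 f :=
    VectorFourier.fourierIntegral_const_smul _ _ _ f c
  unfold wnorm
  rw [← lintegral_const_mul' _ _ enorm_ne_top, hs]
  simp only [Pi.smul_apply, enorm_smul, mul_assoc]

/-- The Roumieu test functions `𝒟^{ω}(Ω)`. -/
def testFn {n : ℕ} (ω : Weight) (Ω : TopologicalSpace.Opens (Rn n)) :
    Submodule ℂ (Rn n → ℂ) where
  carrier := {f | ContDiff ℝ (⊤ : ℕ∞) f ∧ HasCompactSupport f ∧ tsupport f ⊆ Ω ∧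
    ∃ l : ℝ, 0 < l ∧ wnorm ω l f < ∞}
  zero_mem' := by
    refine ⟨contDiff_const, HasCompactSupport.zero, ?_, 1, one_pos, ?_⟩
    · simp [tsupport]
    · have h := wnorm_smul ω 1 0 (0 : Rn n → ℂ)
      rw [zero_smul, enorm_zero, zero_mul] at h
      rw [h]
      exact ENNReal.zero_lt_top
  add_mem' := by
    rintro f g ⟨f1, f2, f3, l, hl, f4⟩ ⟨g1, g2, g3, m, hm, g4⟩
    refine ⟨f1.add g1, f2.add g2,
      (tsupport_add f g).trans (Set.union_subset f3 g3), min l m, lt_min hl hm, ?_⟩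
    refine (wnorm_add_le ω _ (f1.continuous.integrable_of_hasCompactSupport f2)
      (g1.continuous.integrable_of_hasCompactSupport g2)).trans_lt (ENNReal.add_lt_top.2 ⟨?_, ?_⟩)
    · exact (wnorm_mono ω (min_le_left _ _) f).trans_lt f4
    · exact (wnorm_mono ω (min_le_right _ _) g).trans_lt g4
  smul_mem' := by
    rintro c f ⟨f1, f2, f3, l, hl, f4⟩
    refine ⟨f1.const_smul c, f2.smul_left (f := fun _ => c),
      (tsupport_smul_subset_right (fun _ => c) f).trans f3, l, hl, ?_⟩
    rw [wnorm_smul]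
    exact ENNReal.mul_lt_top enorm_lt_top f4

/-- The Roumieu ultradistributions `𝒟'^{ω}(Ω)`: linear functionals on `𝒟^{ω}(Ω)` that are
continuous for its inductive limit topology, i.e. bounded with respect to `‖·‖_l^ω` on the test
functions supported in `K`, for every compact `K ⊆ Ω` and every `l > 0`. -/
structure Ultradistribution {n : ℕ} (ω : Weight) (Ω : TopologicalSpace.Opens (Rn n)) where
  toLin : testFn ω Ω →ₗ[ℂ] ℂ
  bound : ∀ K : Set (Rn n), IsCompact K → K ⊆ Ω → ∀ l : ℝ, 0 < l → ∃ C : ℝ≥0,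
    ∀ ρ : testFn ω Ω, tsupport (ρ : Rn n → ℂ) ⊆ K →
      ‖toLin ρ‖ₑ ≤ C * wnorm ω l (ρ : Rn n → ℂ)

theorem enorm_apply_le_wnorm {n : ℕ} (ω : Weight) {l : ℝ} (hl : 0 < l) {f : Rn n → ℂ}
    (hc : Continuous f) (hi : Integrable f) (a : Rn n) : ‖f a‖ₑ ≤ wnorm ω l f := by
  by_cases hfin : wnorm ω l f = ∞
  · rw [hfin]; exact le_top
  have hF : Integrable (𝓕 f) :=
    ⟨(fourier_measurable hi).aestronglyMeasurable,
      (lintegral_fourier_le_wnorm ω hl.le f).trans_lt (lt_top_iff_ne_top.2 hfin)⟩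
  have hinv := congrFun (hc.fourierInv_fourier_eq hi hF) a
  rw [← hinv, Real.fourierInv_eq]
  refine (enorm_integral_le_lintegral_enorm _).trans ?_
  refine le_trans (le_of_eq ?_) (lintegral_fourier_le_wnorm ω hl.le f)
  refine lintegral_congr fun ξ => ?_
  rw [← ofReal_norm, ← ofReal_norm, Circle.norm_smul]

/-- The Dirac delta at `a`, as a Roumieu ultradistribution. -/
def dirac {n : ℕ} (ω : Weight) (Ω : TopologicalSpace.Opens (Rn n)) (a : Rn n) :
    Ultradistribution ω Ω where
  toLin := (LinearMap.proj a : (Rn n → ℂ) →ₗ[ℂ] ℂ).comp (testFn ω Ω).subtype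
  bound := by
    intro K _ _ l hl
    refine ⟨1, fun ρ _ => ?_⟩
    obtain ⟨h1, h2, -⟩ := ρ.2
    simpa using enorm_apply_le_wnorm ω hl h1.continuous
      (h1.continuous.integrable_of_hasCompactSupport h2) a

/-- The ultradifferentiable functions `ℰ^{ω}(Ω)`. Here and below a function on `Ω` is represented
by a function on `ℝⁿ` whose values outside `Ω` are irrelevant. -/
def ultraFn {n : ℕ} (ω : Weight) (Ω : TopologicalSpace.Opens (Rn n)) : Set (Rn n → ℂ) :=
  {f | ContDiffOn ℝ (⊤ : ℕ∞) f Ω ∧ ∀ χ ∈ testFn ω Ω, χ * f ∈ testFn ω Ω}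

/-- `T ∈ ℰ^{ω}(Ω)`: `T` is given by integration against an ultradifferentiable function. -/
def Ultradistribution.IsUltradifferentiable {n : ℕ} {ω : Weight}
    {Ω : TopologicalSpace.Opens (Rn n)} (T : Ultradistribution ω Ω) : Prop :=
  ∃ f ∈ ultraFn ω Ω, ∀ ρ : testFn ω Ω, T.toLin ρ = ∫ x, f x * (ρ : Rn n → ℂ) x

/-- The local norm `‖f‖_{K,l}^τ`: the infimum of `‖χ f‖_l^τ` over the `χ ∈ 𝒟^{ω}(Ω)` that are equal
to `1` on `K`. -/
def locNorm {n : ℕ} (ω : Weight) (Ω : TopologicalSpace.Opens (Rn n)) (τ : Weight) (l : ℝ)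
    (K : Set (Rn n)) (f : Rn n → ℂ) : ℝ≥0∞ :=
  ⨅ χ ∈ {χ : Rn n → ℂ | χ ∈ testFn ω Ω ∧ ∀ x ∈ K, χ x = 1}, wnorm τ l (χ * f)

/-- The parameter set `(0, 1)` of nets. -/
abbrev Eps := Set.Ioo (0 : ℝ) 1

/-- The filter `ε → 0` on `(0, 1)`. -/
def epsZero : Filter Eps := comap (fun ε : Eps => (ε : ℝ)) (𝓝 0)

/-- Nets `(g_ε)` of functions. -/
abbrev Net (n : ℕ) := Eps → Rn n → ℂ

/-- `N_ε = o(e^{c τ(1/ε)})` as `ε → 0`, for a net `N` in `[0, ∞]`. -/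
def IsLittleOExp (τ : Weight) (c : ℝ) (N : Eps → ℝ≥0∞) : Prop :=
  Tendsto (fun ε : Eps => N ε * ENNReal.ofReal (Real.exp (-(c * τ (1 / (ε : ℝ))))))
    epsZero (𝓝 0)

/-- Moderate nets `ℰ_M^{ω}(Ω)`. -/
def IsModerate {n : ℕ} (ω : Weight) (Ω : TopologicalSpace.Opens (Rn n)) (u : Net n) : Prop :=
  (∀ ε, u ε ∈ ultraFn ω Ω) ∧
  ∀ K : Set (Rn n), IsCompact K → K ⊆ Ω → ∀ k : ℝ, 0 < k → ∃ h : ℝ, 0 < h ∧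
    IsLittleOExp ω k (fun ε => locNorm ω Ω ω h K (u ε))

/-- Negligible nets `𝒩^{ω}(Ω)`. -/
def IsNegligible {n : ℕ} (ω : Weight) (Ω : TopologicalSpace.Opens (Rn n)) (u : Net n) : Prop :=
  (∀ ε, u ε ∈ ultraFn ω Ω) ∧
  ∀ K : Set (Rn n), IsCompact K → K ⊆ Ω → ∃ k : ℝ, 0 < k ∧ ∃ h : ℝ, 0 < h ∧
    IsLittleOExp ω (-k) (fun ε => locNorm ω Ω ω h K (u ε))

/-- Regular nets `ℰ^{ω,∞}(Ω)` (inductive presentation). -/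
def IsRegularNet {n : ℕ} (ω : Weight) (Ω : TopologicalSpace.Opens (Rn n)) (u : Net n) : Prop :=
  IsModerate ω Ω u ∧
  ∀ K : Set (Rn n), IsCompact K → K ⊆ Ω → ∃ h : ℝ, 0 < h ∧ ∀ k : ℝ, 0 < k →
    IsLittleOExp ω k (fun ε => locNorm ω Ω ω h K (u ε))

/-- Regular nets, projective presentation. -/
def IsRegularNetProj {n : ℕ} (ω : Weight) (Ω : TopologicalSpace.Opens (Rn n)) (u : Net n) :
    Prop :=
  IsModerate ω Ω u ∧
  ∀ K : Set (Rn n), IsCompact K → K ⊆ Ω → ∃ ω₁ : Weight, StrongLT ω₁ ω ∧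
    ∀ ω₂ : Weight, StrongLT ω₂ ω → IsLittleOExp ω₁ 1 (fun ε => locNorm ω Ω ω₂ 1 K (u ε))

/-- The factor space `𝒢^{ω}(Ω)` of moderate nets modulo negligible nets: two moderate nets are
identified when their difference is negligible (this relation is an equivalence, and `Quot` is the
set of its classes). -/
def GenFn {n : ℕ} (ω : Weight) (Ω : TopologicalSpace.Opens (Rn n)) : Type :=
  Quot (fun u v : {u : Net n // IsModerate ω Ω u} => IsNegligible ω Ω (u.1 - v.1))

/-- The class `[(u_ε)]` of a moderate net. -/
def GenFn.mk {n : ℕ} {ω : Weight} {Ω : TopologicalSpace.Opens (Rn n)} (u : Net n)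
    (hu : IsModerate ω Ω u) : GenFn ω Ω :=
  Quot.mk _ ⟨u, hu⟩

/-- `g ∈ 𝒢^{ω,∞}(Ω)`. -/
def GenFn.IsRegular {n : ℕ} {ω : Weight} {Ω : TopologicalSpace.Opens (Rn n)} (g : GenFn ω Ω) :
    Prop :=
  ∃ (u : Net n) (hu : IsModerate ω Ω u), GenFn.mk u hu = g ∧ IsRegularNet ω Ω u

/-- `g ∈ 𝒢^{ω,∞}(Ω)`, in the projective presentation. -/
def GenFn.IsRegularProj {n : ℕ} {ω : Weight} {Ω : TopologicalSpace.Opens (Rn n)}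
    (g : GenFn ω Ω) : Prop :=
  ∃ (u : Net n) (hu : IsModerate ω Ω u), GenFn.mk u hu = g ∧ IsRegularNetProj ω Ω u

/-- Strong association of a net with `T`: for every compact `K ⊆ Ω` there is `ω_b << ω` such that
`⟨u_ε - T, ρ⟩ = o(e^{-ω_b(1/ε)})` for all test functions `ρ` supported in `K`. -/
def NetStronglyAssociated {n : ℕ} {ω : Weight} {Ω : TopologicalSpace.Opens (Rn n)}
    (T : Ultradistribution ω Ω) (u : Net n) : Prop :=
  ∀ K : Set (Rn n), IsCompact K → K ⊆ Ω → ∃ ωb : Weight, StrongLT ωb ω ∧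
    ∀ ρ : testFn ω Ω, tsupport (ρ : Rn n → ℂ) ⊆ K →
      (fun ε : Eps => (∫ x, u ε x * (ρ : Rn n → ℂ) x) - T.toLin ρ)
        =o[epsZero] (fun ε : Eps => Real.exp (-(ωb (1 / (ε : ℝ)))))

/-- `T` is strongly associated to the generalized function `g` (through all representatives). -/
def StronglyAssociated {n : ℕ} {ω : Weight} {Ω : TopologicalSpace.Opens (Rn n)}
    (T : Ultradistribution ω Ω) (g : GenFn ω Ω) : Prop :=
  ∀ (u : Net n) (hu : IsModerate ω Ω u), GenFn.mk u hu = g → NetStronglyAssociated T u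

/-- Mollifiers: Schwartz functions whose Fourier transform has compact support and is equal to `1`
in a neighbourhood of `0`. -/
def IsMollifier {n : ℕ} (φ : SchwartzMap (Rn n) ℂ) : Prop :=
  HasCompactSupport (𝓕 (φ : Rn n → ℂ)) ∧ ∀ᶠ ξ in 𝓝 (0 : Rn n), 𝓕 (φ : Rn n → ℂ) ξ = 1

/-- `η` is a slowing down map: `η(ε) > 0` and `ω₁(1/ε) = ω(1/η(ε))`. -/
def IsSlowing (ω ω₁ : Weight) (η : Eps → ℝ) : Prop :=
  ∀ ε : Eps, 0 < η ε ∧ ω₁ (1 / (ε : ℝ)) = ω (1 / η ε)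

/-- The net `φ_{η(ε)}(x - a)`, where `φ_η(x) = η⁻ⁿ φ(x / η)`. -/
def slowedNet {n : ℕ} (φ : SchwartzMap (Rn n) ℂ) (η : Eps → ℝ) (a : Rn n) : Net n :=
  fun ε x => ((η ε : ℂ) ^ n)⁻¹ * φ ((η ε)⁻¹ • (x - a))

end Roumieu

end

namespace Roumieu

/-! Regularity. The Fourier transform of `φ_η(x - a)` is a unimodular character times `φ̂(ηξ)`,
which lives in `|ξ| ≤ R/η`. By subadditivity of the weight, its `l`-norm is therefore at most a
constant times `η^{-n} e^{l m ω(1/η)}` (`exists_wnorm_dilate_le`). Multiplying by a cutoff costs one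
more constant, since the norms are submultiplicative (`wnorm_mul_le`). Slowing down replaces
`ω(1/η)` by `ω₁(1/ε) = o(ω(1/ε))`, and `η^{-n}` is absorbed because `log` is small against `ω`. The
growth is thus below every `e^{kω(1/ε)}` with the single index `h = 1`.

Association. By Parseval, the pairing with `ρ` differs from `ρ(a)` by an integral of `(φ̂(-ηξ) - 1)
ρ̂(ξ)` against a character. The first factor vanishes for `η|ξ| < r`; elsewhere `ω(|ξ|)` dominates a
fixed multiple of `ω(1/η) = ω₁(1/ε)`, so the decay of `ρ̂` yields `O(e^{-cω₁(1/ε)})`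
(`netStronglyAssociated_slowedNet`). Negligible perturbations pair to `O(e^{-kω(1/ε)})`, hence the
representative does not matter.

Both the local norms and the irregularity of the delta need cutoffs in the test space.
`exists_cutoff` builds them from the integrability of `ω(t)/t²` by an infinite convolution. -/

/-! ### Elementary properties of weights. -/

theorem Weight.tendsto_atTop (ω : Weight) : Tendsto ω atTop atTop := by
  have hlog : Tendsto (fun t : ℝ => Real.log (1 + t)) atTop atTop :=
    Real.tendsto_log_atTop.comp (tendsto_atTop_add_const_left _ _ tendsto_id)
  refine (ω.log_little.atTop_mul_atTop₀ hlog).congr' ?_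
  filter_upwards [hlog.eventually_gt_atTop 0] with t ht
  exact div_mul_cancel₀ _ ht.ne'

theorem Weight.nat_mul_le (ω : Weight) (m : ℕ) {t : ℝ} (ht : 0 ≤ t) : ω (m * t) ≤ m * ω t := by
  induction m with
  | zero => simp [ω.map_zero]
  | succ m ih =>
    push_cast
    rw [add_mul, add_mul, one_mul, one_mul]
    exact (ω.subadd _ _ (by positivity) ht).trans (by linarith)

theorem Weight.mul_le (ω : Weight) {r t : ℝ} (hr : 0 ≤ r) (ht : 0 ≤ t) :
    ω (r * t) ≤ ⌈r⌉₊ * ω t := by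
  refine (ω.mono (Set.mem_Ici.2 (by positivity)) (Set.mem_Ici.2 (by positivity)) ?_).trans
    (ω.nat_mul_le ⌈r⌉₊ ht)
  exact mul_le_mul_of_nonneg_right (Nat.le_ceil r) ht

/-- A zero at some `t > 0` would propagate to every `s` through `ω(s) ≤ ⌈s/t⌉ ω(t)`, contradicting
`ω → ∞`. -/
theorem Weight.pos (ω : Weight) {t : ℝ} (ht : 0 < t) : 0 < ω t := by
  refine (ω.nonneg ht.le).lt_of_ne fun h0 => ?_
  obtain ⟨s, hs0, hs⟩ := ((eventually_gt_atTop (0 : ℝ)).and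
    (ω.tendsto_atTop.eventually_gt_atTop 0)).exists
  have h := ω.mul_le (r := s / t) (by positivity) ht.le
  rw [div_mul_cancel₀ _ ht.ne', ← h0, mul_zero] at h
  linarith

theorem Weight.exists_eq (ω : Weight) {y : ℝ} (hy : 0 < y) : ∃ x, 0 < x ∧ ω x = y := by
  obtain ⟨s, hs0, hs⟩ := ((eventually_gt_atTop (0 : ℝ)).and
    (ω.tendsto_atTop.eventually_gt_atTop y)).exists
  obtain ⟨x, hx, rfl⟩ := intermediate_value_Icc hs0.le (ω.cont.mono Set.Icc_subset_Ici_self)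
    (show y ∈ Set.Icc (ω 0) (ω s) from ⟨by rw [ω.map_zero]; exact hy.le, hs.le⟩)
  refine ⟨x, hx.1.lt_of_ne ?_, rfl⟩
  rintro rfl
  rw [ω.map_zero] at hy
  exact lt_irrefl _ hy

theorem exists_isSlowing (ω ω₁ : Weight) : ∃ η : Eps → ℝ, IsSlowing ω ω₁ η := by
  have h : ∀ ε : Eps, ∃ x, 0 < x ∧ ω x = ω₁ (1 / (ε : ℝ)) := fun ε =>
    ω.exists_eq (ω₁.pos (one_div_pos.2 ε.2.1))
  choose x hx0 hx using h
  exact ⟨fun ε => 1 / x ε, fun ε => ⟨one_div_pos.2 (hx0 ε), by rw [one_div_one_div, hx]⟩⟩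

theorem Weight.continuous_norm (ω : Weight) {n : ℕ} : Continuous fun ξ : Rn n => ω ‖ξ‖ :=
  ω.cont.comp_continuous _root_.continuous_norm fun ξ => norm_nonneg ξ

theorem Weight.norm_le (ω : Weight) {n : ℕ} (ξ ζ : Rn n) : ω ‖ξ‖ ≤ ω ‖ξ - ζ‖ + ω ‖ζ‖ := by
  refine (ω.mono (Set.mem_Ici.2 (norm_nonneg _)) (Set.mem_Ici.2 (by positivity)) ?_).trans
    (ω.subadd _ _ (norm_nonneg _) (norm_nonneg _))
  simpa using norm_add_le (ξ - ζ) ζ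

/-- Monotonicity bounds `g` on the initial interval, so an asymptotic comparison becomes one valid
on all of `[0, ∞)`. This matters because `1/η(ε)` is never shown to tend to infinity. -/
theorem Weight.le_mul_add_of_isLittleO (ω : Weight) {g : ℝ → ℝ} (hg : MonotoneOn g (Set.Ici 0))
    (h : g =o[atTop] ω.toFun) {c : ℝ} (hc : 0 < c) :
    ∃ C, 0 ≤ C ∧ ∀ t, 0 ≤ t → g t ≤ c * ω t + C := by
  obtain ⟨A, hA⟩ := eventually_atTop.1 (h.bound hc)
  refine ⟨|g (max A 0)|, abs_nonneg _, fun t ht => ?_⟩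
  have hω := ω.nonneg ht
  rcases le_total (max A 0) t with h1 | h1
  · have h2 := hA t (le_of_max_le_left h1)
    rw [Real.norm_eq_abs, Real.norm_eq_abs, abs_of_nonneg hω] at h2
    linarith [le_abs_self (g t), abs_nonneg (g (max A 0))]
  · have h2 := hg (Set.mem_Ici.2 ht) (Set.mem_Ici.2 (le_max_right A 0)) h1
    have := mul_nonneg hc.le hω
    linarith [le_abs_self (g (max A 0))]

theorem StrongLT.mul_le_mul_add {ω₁ ω : Weight} (h : StrongLT ω₁ ω) {m c : ℝ} (hm : 0 ≤ m)
    (hc : 0 < c) : ∃ C, 0 ≤ C ∧ ∀ t, 0 ≤ t → m * ω₁ t ≤ c * ω t + C :=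
  ω.le_mul_add_of_isLittleO (fun _ hx _ hy hxy => mul_le_mul_of_nonneg_left (ω₁.mono hx hy hxy) hm)
    (h.const_mul_left m) hc

theorem StrongLT.trans {ω₁ ω₂ ω₃ : Weight} (h : StrongLT ω₁ ω₂) (h' : StrongLT ω₂ ω₃) :
    StrongLT ω₁ ω₃ :=
  IsLittleO.trans h h'

/-! ### Comparison with the logarithm, and a weight far below a given one. -/

theorem Weight.log_isLittleO (ω : Weight) :
    (fun t => Real.log (1 + t)) =o[atTop] ω.toFun := by
  have hω := ω.tendsto_atTop.eventually_gt_atTop 0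
  rw [isLittleO_iff_tendsto' (hω.mono fun t ht h0 => absurd h0 ht.ne')]
  refine ω.log_little.inv_tendsto_atTop.congr fun t => ?_
  simp

theorem monotoneOn_log_one_add {T : ℝ} (hT : 0 < T) :
    MonotoneOn (fun t => Real.log (1 + t / T)) (Set.Ici 0) := by
  intro x hx y _ hxy
  have hx : 0 ≤ x := hx
  refine Real.log_le_log (by positivity) ?_
  gcongr

theorem Weight.mul_log_le_mul_add (ω : Weight) {m c : ℝ} (hm : 0 ≤ m) (hc : 0 < c) :
    ∃ C, 0 ≤ C ∧ ∀ t, 0 ≤ t → m * Real.log (1 + t) ≤ c * ω t + C :=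
  ω.le_mul_add_of_isLittleO (fun x hx y hy hxy => mul_le_mul_of_nonneg_left
    (by simpa using monotoneOn_log_one_add one_pos hx hy hxy) hm)
    (ω.log_isLittleO.const_mul_left m) hc

/-- For large `t` the left side is at most `log(1 + t) ≤ cω(t)`; on the remaining bounded range it
is at most `t/T ≤ c`, which is what the `+ 1` pays for. -/
theorem Weight.exists_log_div_le (ω : Weight) {c : ℝ} (hc : 0 < c) :
    ∃ T, 1 ≤ T ∧ ∀ t, 0 ≤ t → Real.log (1 + t / T) ≤ c * (ω t + 1) := by
  obtain ⟨A, hA⟩ := eventually_atTop.1 (ω.log_isLittleO.bound hc)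
  have hT : 0 < max 1 (A / c) := lt_of_lt_of_le one_pos (le_max_left _ _)
  refine ⟨max 1 (A / c), le_max_left _ _, fun t ht => ?_⟩
  have hω := ω.nonneg ht
  rcases le_total A t with h1 | h1
  · have h2 := hA t h1
    rw [Real.norm_eq_abs, Real.norm_eq_abs, abs_of_nonneg hω] at h2
    have h3 : Real.log (1 + t / max 1 (A / c)) ≤ Real.log (1 + t) := by
      refine Real.log_le_log (by positivity) ?_
      gcongr
      exact div_le_self ht (le_max_left _ _)
    nlinarith [le_abs_self (Real.log (1 + t))]
  · have h2 : t / max 1 (A / c) ≤ c := by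
      rw [div_le_iff₀ hT]
      have := mul_le_mul_of_nonneg_left (le_max_right 1 (A / c)) hc.le
      rw [mul_div_cancel₀ _ hc.ne'] at this
      linarith
    have h3 := Real.log_le_sub_one_of_pos (show 0 < 1 + t / max 1 (A / c) by positivity)
    nlinarith

/-- The witness is `∑ log(1 + t/T_j)` with the `j`-th term at most `2^{-j}(ω(t) + 1)`. Each term is
subadditive and comparable to `log t`, so infinitely many of them beat `log`, while dominated
convergence keeps the sum `o(ω)`. -/
theorem exists_strongLT (ω : Weight) : ∃ ω₁ : Weight, StrongLT ω₁ ω := by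
  choose T hT1 hT using fun j : ℕ => ω.exists_log_div_le (c := (1 / 2 : ℝ) ^ j) (by positivity)
  have hT0 : ∀ j, 0 < T j := fun j => one_pos.trans_le (hT1 j)
  set g : ℕ → ℝ → ℝ := fun j t => Real.log (1 + t / T j) with hg
  have hg0 : ∀ j t, 0 ≤ t → 0 ≤ g j t := fun j t ht =>
    Real.log_nonneg (by have := hT0 j; have : 0 ≤ t / T j := by positivity
                        linarith)
  have hgeo : Summable fun j : ℕ => (1 / 2 : ℝ) ^ j := summable_geometric_two
  have hsum : ∀ t, 0 ≤ t → Summable fun j => g j t := fun t ht =>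
    Summable.of_nonneg_of_le (fun j => hg0 j t ht) (fun j => hT j t ht) (hgeo.mul_right _)
  have hle : ∀ t, 0 ≤ t → ∑' j, g j t ≤ 2 * (ω t + 1) := fun t ht => by
    refine ((hsum t ht).tsum_le_tsum (fun j => hT j t ht) (hgeo.mul_right _)).trans ?_
    rw [tsum_mul_right, tsum_geometric_two]
  have hcont : ContinuousOn (fun t => ∑' j, g j t) (Set.Ici 0) := by
    intro x hx
    have hx : 0 ≤ x := hx
    have h1 : ContinuousOn (fun t => ∑' j, g j t) (Set.Icc 0 (x + 1)) := by
      refine continuousOn_tsum (u := fun j => (1 / 2 : ℝ) ^ j * (ω (x + 1) + 1)) (fun j => ?_)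
        (hgeo.mul_right _) fun j t ht => ?_
      · refine ContinuousOn.log (by fun_prop) fun t ht => ?_
        have := hT0 j
        have := ht.1
        positivity
      · rw [Real.norm_eq_abs, abs_of_nonneg (hg0 j t ht.1)]
        refine (hT j t ht.1).trans ?_
        gcongr
        exact ω.mono ht.1 (Set.mem_Ici.2 (by linarith)) ht.2
    refine (h1 x ⟨hx, by linarith⟩).mono_of_mem_nhdsWithin ?_
    filter_upwards [self_mem_nhdsWithin, mem_nhdsWithin_of_mem_nhds (Iio_mem_nhds (lt_add_one x))]
      with t ht1 ht2 using ⟨ht1, ht2.le⟩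
  have hmono : MonotoneOn (fun t => ∑' j, g j t) (Set.Ici 0) := fun x hx y hy hxy =>
    (hsum x hx).tsum_le_tsum (fun j => monotoneOn_log_one_add (hT0 j) hx hy hxy) (hsum y hy)
  refine ⟨⟨fun t => ∑' j, g j t, hcont, hmono, by simp [hg], ?_, ?_, ?_⟩, ?_⟩
  · intro x y hx hy
    rw [← (hsum x hx).tsum_add (hsum y hy)]
    refine (hsum _ (add_nonneg hx hy)).tsum_le_tsum (fun j => ?_) ((hsum x hx).add (hsum y hy))
    have := hT0 j
    rw [hg, ← Real.log_mul (by positivity) (by positivity)]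
    refine Real.log_le_log (by positivity) ?_
    have : 0 ≤ x / T j * (y / T j) := by positivity
    rw [add_div]
    nlinarith
  · have h1 : IntegrableOn (fun t : ℝ => t ^ (-2 : ℝ)) (Set.Ioi 1) :=
      integrableOn_Ioi_rpow_of_lt (by norm_num) one_pos
    refine Integrable.mono' ((ω.integrable.add h1).const_mul 2) ?_ ?_
    · refine ContinuousOn.aestronglyMeasurable ?_ measurableSet_Ioi
      refine (hcont.mono fun t (ht : 1 < t) => Set.mem_Ici.2 (by linarith)).div (by fun_prop) ?_
      intro t (ht : 1 < t)
      positivity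
    · refine (ae_restrict_iff' measurableSet_Ioi).2 (.of_forall fun t (ht : 1 < t) => ?_)
      have ht0 : 0 < t := by linarith
      rw [Real.norm_eq_abs, abs_of_nonneg (div_nonneg (tsum_nonneg fun j => hg0 j t ht0.le)
        (by positivity)), Pi.add_apply, Real.rpow_neg ht0.le, Real.rpow_two, ← one_div, ← add_div,
        ← mul_div_assoc]
      gcongr
      exact hle t ht0.le
  · refine tendsto_atTop.2 fun M => ?_
    -- Once `t ≥ T_j²`, one has `1 + t ≤ (1 + t/T_j)²`, so each of the first `J` terms contributes
    -- at least half of `log(1 + t)`.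
    obtain ⟨J, hJ⟩ := exists_nat_ge (2 * M)
    have h1 : ∀ᶠ t : ℝ in atTop, ∀ j ∈ Finset.range J, T j ^ 2 ≤ t :=
      (Finset.eventually_all _).2 fun j _ => eventually_ge_atTop _
    filter_upwards [h1, eventually_gt_atTop 0] with t ht ht0
    have hlog : 0 < Real.log (1 + t) := Real.log_pos (by linarith)
    rw [le_div_iff₀ hlog]
    have h2 : ∀ j ∈ Finset.range J, Real.log (1 + t) / 2 ≤ g j t := fun j hj => by
      have h3 := ht j hj
      have h4 := hT0 j
      rw [div_le_iff₀ two_pos, mul_comm, hg, ← Nat.cast_two, ← Real.log_pow]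
      refine Real.log_le_log (by linarith) ?_
      have h5 : t ≤ (t / T j) ^ 2 := by
        rw [div_pow, le_div_iff₀ (by positivity)]
        nlinarith
      have : 0 ≤ t / T j := by positivity
      nlinarith
    have h6 := Finset.sum_le_sum h2
    rw [Finset.sum_const, Finset.card_range, nsmul_eq_mul] at h6
    refine le_trans ?_ (h6.trans ((hsum t ht0.le).sum_le_tsum _ fun j _ => hg0 j t ht0.le))
    nlinarith
  · have hω := ω.tendsto_atTop.eventually_ge_atTop 1
    refine (isLittleO_iff_tendsto' (hω.mono fun t ht h0 => by linarith)).2 ?_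
    have key : Tendsto (fun t => ∑' j, g j t / ω t) atTop (𝓝 (∑' _ : ℕ, (0 : ℝ))) := by
      refine tendsto_tsum_of_dominated_convergence (hgeo.mul_right 2) (fun j => ?_) ?_
      · have h1 : g j =O[atTop] fun t => Real.log (1 + t) := by
          refine IsBigO.of_bound 1 ?_
          filter_upwards [eventually_ge_atTop 0] with t ht
          have := hT0 j
          rw [one_mul, Real.norm_eq_abs, abs_of_nonneg (hg0 j t ht)]
          refine le_trans ?_ (le_abs_self _)
          refine Real.log_le_log (by positivity) ?_
          gcongr
          exact div_le_self ht (hT1 j)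
        exact (h1.trans_isLittleO ω.log_isLittleO).tendsto_div_nhds_zero
      · filter_upwards [hω, eventually_ge_atTop 0] with t ht ht0 j
        rw [Real.norm_eq_abs, abs_of_nonneg (div_nonneg (hg0 j t ht0) (by linarith)),
          div_le_iff₀ (by linarith)]
        refine (hT j t ht0).trans ?_
        rw [mul_assoc]
        gcongr
        linarith
    simpa only [tsum_div_const, tsum_zero] using key

theorem tendsto_one_div_epsZero : Tendsto (fun ε : Eps => 1 / (ε : ℝ)) epsZero atTop := by
  have h : Tendsto (fun ε : Eps => (ε : ℝ)) epsZero (𝓝[>] 0) :=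
    tendsto_nhdsWithin_iff.2 ⟨tendsto_comap, .of_forall fun ε => ε.2.1⟩
  simp only [one_div]
  exact h.inv_tendsto_nhdsGT_zero

theorem Weight.tendsto_epsZero (ω : Weight) :
    Tendsto (fun ε : Eps => ω (1 / (ε : ℝ))) epsZero atTop :=
  ω.tendsto_atTop.comp tendsto_one_div_epsZero

theorem StrongLT.exp_isLittleO {ω₁ ω : Weight} (h : StrongLT ω₁ ω) {c : ℝ} (hc : 0 < c) :
    (fun ε : Eps => Real.exp (-(c * ω (1 / (ε : ℝ)))))
      =o[epsZero] fun ε : Eps => Real.exp (-(ω₁ (1 / (ε : ℝ)))) := by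
  rw [Real.isLittleO_exp_comp_exp_comp]
  obtain ⟨C, -, hC⟩ := h.mul_le_mul_add zero_le_one (half_pos hc)
  refine tendsto_atTop_mono (fun ε => ?_)
    (tendsto_atTop_add_const_right _ (-C) (ω.tendsto_epsZero.const_mul_atTop (half_pos hc)))
  have := hC _ (one_div_nonneg.2 ε.2.1.le)
  linarith

/-! ### Cutoff functions from non-quasianalyticity. -/

/-- Scales `R / t` at which a non-quasianalytic weight is consumed: at least `ω t - C` of them have
size `≥ R / t`, and their sum is small. -/
theorem Weight.exists_scales (ω : Weight) {R δ : ℝ} (hR : 0 < R) (hδ : 0 < δ) :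
    ∃ a : ℕ → ℝ, (∀ j, 0 ≤ a j) ∧ Summable a ∧ ∑' j, a j ≤ δ ∧
      ∃ C : ℝ, ∀ t, 0 ≤ t → ∀ j : ℕ, (j : ℝ) < ω t - C → R ≤ a j * t := by
  have hω1 := ω.nonneg zero_le_one
  have h : ∀ j : ℕ, ∃ t, 0 < t ∧ ω t = ω 1 + (j + 1) := fun j => ω.exists_eq (by positivity)
  choose t ht0 ht using h
  have ht1 : ∀ j, 1 < t j := fun j => by
    by_contra! hj
    have := ω.mono (Set.mem_Ici.2 (ht0 j).le) (Set.mem_Ici.2 zero_le_one) hj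
    rw [ht] at this
    have : (0 : ℝ) ≤ j := j.cast_nonneg
    linarith
  have hint : ∀ j, IntegrableOn (fun s : ℝ => s ^ (-2 : ℝ)) (Set.Ioi (t j)) := fun j =>
    integrableOn_Ioi_rpow_of_lt (by norm_num) (ht0 j)
  have hval : ∀ j, 1 / t j =
      ∫ s in Set.Ioi (1 : ℝ), (Set.Ioi (t j)).indicator (fun s : ℝ => s ^ (-2 : ℝ)) s := fun j => by
    rw [setIntegral_indicator measurableSet_Ioi, Set.inter_eq_right.2
      (Set.Ioi_subset_Ioi (ht1 j).le), integral_Ioi_rpow_of_lt (by norm_num) (ht0 j)]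
    norm_num
    rw [Real.rpow_neg_one]
  have hsum : Summable fun j => 1 / t j := by
    refine summable_of_sum_range_le (c := ∫ s in Set.Ioi (1 : ℝ), ω s / s ^ 2)
      (fun j => (one_div_pos.2 (ht0 j)).le) fun N => ?_
    simp_rw [hval]
    have hI : ∀ j ∈ Finset.range N, IntegrableOn
        ((Set.Ioi (t j)).indicator fun s : ℝ => s ^ (-2 : ℝ)) (Set.Ioi 1) := fun j _ =>
      ((hint j).integrable_indicator measurableSet_Ioi).integrableOn
    rw [← integral_finsetSum _ hI]
    refine setIntegral_mono_on (integrable_finsetSum _ hI) ω.integrable measurableSet_Ioi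
      fun s (hs : 1 < s) => ?_
    have hs0 : 0 < s := one_pos.trans hs
    have hωs := ω.nonneg hs0.le
    -- If `t_j < s` then `j + 1 ≤ ω(s)`, so at most `⌊ω(s)⌋` indicators are nonzero at `s`; this
    -- bounds `∑ 1/t_j` by `∫ ω(s)/s²`.
    calc ∑ j ∈ Finset.range N, (Set.Ioi (t j)).indicator (fun s : ℝ => s ^ (-2 : ℝ)) s
        ≤ ∑ j ∈ Finset.range ⌊ω s⌋₊, s ^ (-2 : ℝ) := by
          simp_rw [Set.indicator_apply]
          rw [← Finset.sum_filter]
          refine Finset.sum_le_sum_of_subset_of_nonneg (fun j hj => ?_) fun _ _ _ => by positivity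
          have hjs : t j < s := (Finset.mem_filter.1 hj).2
          have h2 := ω.mono (Set.mem_Ici.2 (ht0 j).le) (Set.mem_Ici.2 hs0.le) hjs.le
          rw [ht] at h2
          rw [Finset.mem_range, ← Nat.succ_le_iff, Nat.le_floor_iff hωs]
          push_cast
          linarith
      _ ≤ ω s / s ^ 2 := by
          rw [Finset.sum_const, Finset.card_range, nsmul_eq_mul, Real.rpow_neg hs0.le,
            Real.rpow_two, ← div_eq_mul_inv]
          gcongr
          exact Nat.floor_le hωs
  have hsumR : Summable fun j => R / t j := by
    simpa only [mul_one_div] using hsum.mul_left R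
  -- Dropping the first `J` scales makes the sum small and only increases the constant `C`.
  obtain ⟨J, hJ⟩ := ((tendsto_sum_nat_add fun j => R / t j).eventually_le_const hδ).exists
  refine ⟨fun j => R / t (j + J), fun j => (div_pos hR (ht0 _)).le,
    (summable_nat_add_iff J).2 hsumR, hJ, ω 1 + J + 1, fun s hs j hj => ?_⟩
  have h1 : t (j + J) ≤ s := by
    by_contra! h1
    have h2 := ω.mono (Set.mem_Ici.2 hs) (Set.mem_Ici.2 (ht0 _).le) h1.le
    rw [ht] at h2
    push_cast at h2
    linarith
  rw [div_mul_eq_mul_div, le_div_iff₀ (ht0 _)]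
  gcongr

variable {n : ℕ}

/-- Normalized Lebesgue measure on the unit ball works, by the Riemann–Lebesgue lemma. Each smearing
at scale `a` then gains a factor `e^{-1}` at frequencies `|ξ| ≥ R/a`. -/
theorem exists_isProbabilityMeasure_fourier_le (n : ℕ) :
    ∃ (μ : Measure (Rn n)) (R : ℝ), IsProbabilityMeasure μ ∧ 0 < R ∧ (∀ᵐ y ∂μ, ‖y‖ ≤ 1) ∧
      ∀ ξ : Rn n, R ≤ ‖ξ‖ → ‖∫ y, (Real.fourierChar (-inner ℝ y ξ) : ℂ) ∂μ‖ ≤ Real.exp (-1) := by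
  set B : Set (Rn n) := Metric.closedBall 0 1
  have hB0 : volume B ≠ 0 := (Metric.measure_closedBall_pos volume _ one_pos).ne'
  have hB1 : volume B ≠ ∞ := (isCompact_closedBall _ _).measure_lt_top.ne
  have hval : ∀ ξ : Rn n,
      ∫ y, (Real.fourierChar (-inner ℝ y ξ) : ℂ) ∂(ProbabilityTheory.cond volume B) =
      (volume B)⁻¹.toReal • ∫ y, Real.fourierChar (-inner ℝ y ξ) • B.indicator (1 : Rn n → ℂ) y :=
    fun ξ => by
      rw [ProbabilityTheory.cond, integral_smul_measure,
        ← integral_indicator Metric.isClosed_closedBall.measurableSet]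
      congr 2 with y
      by_cases hy : y ∈ B
      · rw [Set.indicator_of_mem hy, Set.indicator_of_mem hy]
        simp [Circle.smul_def]
      · rw [Set.indicator_of_notMem hy, Set.indicator_of_notMem hy, smul_zero]
  have hlim := (tendsto_integral_exp_inner_smul_cocompact
    (B.indicator (1 : Rn n → ℂ))).const_smul (volume B)⁻¹.toReal
  simp_rw [smul_zero, ← hval] at hlim
  have hev := (hlim.norm).eventually_le_const (show ‖(0 : ℂ)‖ < Real.exp (-1) by
    rw [norm_zero]; positivity)
  rw [← Metric.cobounded_eq_cocompact, ← comap_norm_atTop, eventually_comap] at hev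
  obtain ⟨R, hR⟩ := eventually_atTop.1 hev
  refine ⟨ProbabilityTheory.cond volume B, max R 1,
    ProbabilityTheory.cond_isProbabilityMeasure_of_finite hB0 hB1, by positivity, ?_,
    fun ξ hξ => hR ‖ξ‖ (le_of_max_le_left hξ) ξ rfl⟩
  filter_upwards [ProbabilityTheory.ae_cond_mem Metric.isClosed_closedBall.measurableSet]
    with y hy
  simpa [B] using hy

/-- The average of `f (x - a • y)` over `y`. -/
noncomputable def smear (μ : Measure (Rn n)) (a : ℝ) (f : Rn n → ℂ) (x : Rn n) : ℂ := ∫ y, f (x - a • y) ∂μ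

section smear

variable {μ : Measure (Rn n)} [IsProbabilityMeasure μ] {a : ℝ} {f : Rn n → ℂ} {L : ℝ≥0}

theorem integrable_smear (hf : Continuous f) (hb : ∀ x, ‖f x‖ ≤ 1) (x : Rn n) :
    Integrable (fun y => f (x - a • y)) μ :=
  (integrable_const (1 : ℝ)).mono' (by fun_prop) (.of_forall fun _ => hb _)

theorem norm_smear_le (hb : ∀ x, ‖f x‖ ≤ 1) (x : Rn n) : ‖smear μ a f x‖ ≤ 1 := by
  simpa [smear] using
    norm_integral_le_of_norm_le_const (μ := μ) (.of_forall fun y => hb (x - a • y))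

theorem lipschitzWith_smear (hL : LipschitzWith L f) (hb : ∀ x, ‖f x‖ ≤ 1) :
    LipschitzWith L (smear μ a f) := by
  refine LipschitzWith.of_dist_le_mul fun x x' => ?_
  rw [dist_eq_norm, smear, smear, ← integral_sub (integrable_smear hL.continuous hb x)
    (integrable_smear hL.continuous hb x')]
  simpa using norm_integral_le_of_norm_le_const (μ := μ) (.of_forall fun y => by
    simpa [dist_eq_norm] using hL.dist_le_mul (x - a • y) (x' - a • y))

theorem norm_smear_sub_le (hL : LipschitzWith L f) (hb : ∀ x, ‖f x‖ ≤ 1) (ha : 0 ≤ a)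
    (hμ : ∀ᵐ y ∂μ, ‖y‖ ≤ 1) (x : Rn n) : ‖smear μ a f x - f x‖ ≤ L * a := by
  have h1 : f x = ∫ _, f x ∂μ := by simp
  rw [h1, smear, ← integral_sub (integrable_smear hL.continuous hb x) (integrable_const _)]
  refine (norm_integral_le_of_norm_le_const (μ := μ) (C := L * a) ?_).trans_eq (by simp)
  filter_upwards [hμ] with y hy
  have := hL.dist_le_mul (x - a • y) x
  rw [dist_eq_norm, dist_eq_norm, sub_sub_cancel_left, norm_neg, norm_smul, Real.norm_eq_abs,
    abs_of_nonneg ha] at this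
  refine this.trans ?_
  gcongr
  exact mul_le_of_le_one_right ha hy

theorem smear_eq (ha : 0 ≤ a) (hμ : ∀ᵐ y ∂μ, ‖y‖ ≤ 1) {c : ℂ} {x : Rn n}
    (h : ∀ z, dist z x ≤ a → f z = c) : smear μ a f x = c := by
  have h1 : (fun y => f (x - a • y)) =ᵐ[μ] fun _ => c := by
    filter_upwards [hμ] with y hy
    refine h _ ?_
    rw [dist_eq_norm, sub_sub_cancel_left, norm_neg, norm_smul, Real.norm_eq_abs,
      abs_of_nonneg ha]
    exact mul_le_of_le_one_right ha hy
  rw [smear, integral_congr_ae h1]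
  simp

theorem fourier_smear (hf : Continuous f) (hi : Integrable f) (ξ : Rn n) :
    𝓕 (smear μ a f) ξ = 𝓕 f ξ * ∫ y, (Real.fourierChar (-inner ℝ y (a • ξ)) : ℂ) ∂μ := by
  have hmeas : Continuous fun p : Rn n × Rn n =>
      Real.fourierChar (-inner ℝ p.1 ξ) • f (p.1 - a • p.2) :=
    (Real.continuous_fourierChar.comp (by fun_prop)).smul (by fun_prop)
  have hint : Integrable (fun p : Rn n × Rn n =>
      Real.fourierChar (-inner ℝ p.1 ξ) • f (p.1 - a • p.2)) (volume.prod μ) := by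
    refine (integrable_prod_iff' hmeas.aestronglyMeasurable).2 ⟨.of_forall fun y => ?_, ?_⟩
    · exact (Real.fourierIntegral_convergent_iff ξ).2 (hi.comp_sub_right (a • y))
    · simp_rw [Circle.norm_smul]
      simp_rw [integral_sub_right_eq_self (fun x => ‖f x‖)]
      exact integrable_const _
  calc 𝓕 (smear μ a f) ξ
      = ∫ x, ∫ y, Real.fourierChar (-inner ℝ x ξ) • f (x - a • y) ∂μ := by
        rw [Real.fourier_eq]
        refine integral_congr_ae (.of_forall fun x => ?_)
        simp only [smear, Circle.smul_def]
        exact (integral_smul _ _).symm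
    _ = ∫ y, (∫ x, Real.fourierChar (-inner ℝ x ξ) • f (x - a • y)) ∂μ :=
        integral_integral_swap
          (f := fun x y => Real.fourierChar (-inner ℝ x ξ) • f (x - a • y)) hint
    _ = ∫ y, 𝓕 f ξ * (Real.fourierChar (-inner ℝ y (a • ξ)) : ℂ) ∂μ := by
        refine integral_congr_ae (.of_forall fun y => ?_)
        dsimp only
        rw [← integral_add_right_eq_self _ (a • y), Real.fourier_eq, ← integral_mul_const]
        refine integral_congr_ae (.of_forall fun x => ?_)
        simp only [add_sub_cancel_right, inner_add_left, neg_add, AddChar.map_add_eq_mul,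
          Circle.smul_def, Circle.coe_mul, inner_smul_left, inner_smul_right, smul_eq_mul]
        simp only [conj_trivial]
        ring
    _ = _ := integral_const_mul _ _

end smear

theorem exists_contDiff_one_zero {K : Set (Rn n)} {δ : ℝ} (hδ : 0 < δ) :
    ∃ f : Rn n → ℂ, ContDiff ℝ (⊤ : ℕ∞) f ∧ (∀ x, ‖f x‖ ≤ 1) ∧
      (∀ x ∈ Metric.cthickening δ K, f x = 1) ∧ ∀ x ∉ Metric.cthickening (2 * δ) K, f x = 0 := by
  obtain ⟨f, h1, h0, hf⟩ := exists_contMDiffMap_one_nhds_of_subset_interior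
    (modelWithCornersSelf ℝ (Rn n)) (n := (⊤ : ℕ∞))
    (s := Metric.cthickening δ K) (t := Metric.cthickening (2 * δ) K)
    Metric.isClosed_cthickening
    ((Metric.cthickening_subset_thickening' (by linarith) (by linarith) K).trans
      (Metric.thickening_subset_interior_cthickening _ K))
  refine ⟨fun x => (f x : ℂ), Complex.ofRealCLM.contDiff.comp f.contMDiff.contDiff, fun x => ?_,
    fun x hx => ?_, fun x hx => ?_⟩
  · rw [Complex.norm_real, Real.norm_eq_abs, abs_of_nonneg (hf x).1]
    exact (hf x).2
  · beta_reduce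
    rw [h1.self_of_nhdsSet x hx, Complex.ofReal_one]
  · beta_reduce
    rw [h0 x hx, Complex.ofReal_zero]

theorem contDiff_of_pow_mul_fourier {f : Rn n → ℂ} (hc : Continuous f) (hi : Integrable f)
    (h : ∀ k : ℕ, Integrable fun ξ => ‖ξ‖ ^ k * ‖𝓕 f ξ‖) : ContDiff ℝ (⊤ : ℕ∞) f := by
  have hF : Integrable (𝓕 f) := by
    refine (integrable_norm_iff (fourier_measurable hi).aestronglyMeasurable).1 ?_
    simpa using h 0
  have h1 : f = 𝓕 (fun ξ => 𝓕 f (-ξ)) := by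
    rw [← Real.fourierInv_eq_fourier_comp_neg, hc.fourierInv_fourier_eq hi hF]
  rw [h1]
  refine Real.contDiff_fourier fun k _ => ?_
  simpa using (h k).comp_neg

/-- A smooth bump `f` is smeared successively at the scales of `Weight.exists_scales`. The total
displacement is at most `δ`, so plateau and support survive in the limit, while about `ω(|ξ|)` of
the smearings gain `e^{-1}` at frequency `ξ`. Hence `|χ̂(ξ)| ≤ |f̂(ξ)| e^{C - ω(|ξ|)}`. -/
theorem exists_cutoff (ω : Weight) {K U : Set (Rn n)} (hK : IsCompact K) (hU : IsOpen U)
    (hKU : K ⊆ U) :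
    ∃ χ : Rn n → ℂ, ContDiff ℝ (⊤ : ℕ∞) χ ∧ HasCompactSupport χ ∧ tsupport χ ⊆ U ∧
      wnorm ω 1 χ < ∞ ∧ (∀ x ∈ K, χ x = 1) ∧ ∀ x, ‖χ x‖ ≤ 1 := by
  obtain ⟨δ', hδ', hδU⟩ := hK.exists_cthickening_subset_open hU hKU
  -- One `δ` for the plateau margin, one for the descent of `f`, one for the smearing.
  obtain ⟨δ, rfl⟩ : ∃ δ, δ' = 3 * δ := ⟨δ' / 3, by ring⟩
  have hδ : 0 < δ := by linarith
  obtain ⟨μ, R, hμp, hR, hμ1, hμR⟩ := exists_isProbabilityMeasure_fourier_le n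
  obtain ⟨a, ha0, hasum, haδ, C, haC⟩ := ω.exists_scales hR hδ
  obtain ⟨f, hf, hf1, hfK, hf0⟩ := exists_contDiff_one_zero (K := K) hδ
  set V : Set (Rn n) := Metric.cthickening (3 * δ) K
  have hVc : IsCompact V := hK.cthickening
  have hfsupp : HasCompactSupport f := HasCompactSupport.intro (hK.cthickening (r := 2 * δ)) hf0
  obtain ⟨L, hL⟩ := hf.lipschitzWith_of_hasCompactSupport hfsupp (by simp)
  let g : ℕ → Rn n → ℂ := fun j => Nat.rec f (fun j u => smear μ (a j) u) j
  have hgs : ∀ j, g (j + 1) = smear μ (a j) (g j) := fun j => rfl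
  have hgL : ∀ j, LipschitzWith L (g j) ∧ ∀ x, ‖g j x‖ ≤ 1 := fun j => by
    induction j with
    | zero => exact ⟨hL, hf1⟩
    | succ j ih => exact ⟨lipschitzWith_smear ih.1 ih.2, norm_smear_le ih.2⟩
  have hgc : ∀ j (c : ℂ) x, (∀ z, dist z x ≤ ∑ i ∈ Finset.range j, a i → f z = c) →
      g j x = c := fun j => by
    induction j with
    | zero => exact fun c x h => h x (by simp)
    | succ j ih =>
      refine fun c x h => smear_eq (ha0 j) hμ1 fun z hz => ih c z fun w hw => h w ?_
      rw [Finset.sum_range_succ]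
      linarith [dist_triangle w z x]
  have hsumδ : ∀ j, ∑ i ∈ Finset.range j, a i ≤ δ := fun j =>
    (hasum.sum_le_tsum _ fun i _ => ha0 i).trans haδ
  have hg1 : ∀ j, ∀ x ∈ K, g j x = 1 := fun j x hx => hgc j 1 x fun z hz =>
    hfK z (Metric.mem_cthickening_of_dist_le z x δ K hx (hz.trans (hsumδ j)))
  have hg0 : ∀ j, ∀ x ∉ V, g j x = 0 := fun j x hx => hgc j 0 x fun z hz => hf0 z fun hzK => by
    refine hx ?_
    have h1 := Metric.mem_cthickening_of_dist_le x z δ _ hzK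
      (by rw [dist_comm]; exact hz.trans (hsumδ j))
    have h2 := Metric.cthickening_cthickening_subset hδ.le (by linarith) K h1
    rwa [show δ + 2 * δ = 3 * δ by ring] at h2
  have hgi : ∀ j, Integrable (g j) := fun j =>
    (hgL j).1.continuous.integrable_of_hasCompactSupport (HasCompactSupport.intro hVc (hg0 j))
  have hcauchy : ∀ x, CauchySeq fun j => g j x := fun x =>
    cauchySeq_of_dist_le_of_summable (fun j => L * a j) (fun j => by
      rw [dist_comm, dist_eq_norm]
      exact norm_smear_sub_le (hgL j).1 (hgL j).2 (ha0 j) hμ1 x) (hasum.mul_left _)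
  choose χ hχ using fun x => cauchySeq_tendsto_of_complete (hcauchy x)
  have hχL : LipschitzWith L χ := LipschitzWith.of_dist_le_mul fun x y =>
    le_of_tendsto ((hχ x).dist (hχ y)) (.of_forall fun j => (hgL j).1.dist_le_mul x y)
  have hχ1 : ∀ x, ‖χ x‖ ≤ 1 := fun x =>
    le_of_tendsto (hχ x).norm (.of_forall fun j => (hgL j).2 x)
  have hχK : ∀ x ∈ K, χ x = 1 := fun x hx => by
    refine tendsto_nhds_unique (hχ x) ?_
    simp_rw [hg1 _ x hx]
    exact tendsto_const_nhds
  have hχ0 : ∀ x ∉ V, χ x = 0 := fun x hx => by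
    refine tendsto_nhds_unique (hχ x) ?_
    simp_rw [hg0 _ x hx]
    exact tendsto_const_nhds
  have hχs : HasCompactSupport χ := HasCompactSupport.intro hVc hχ0
  have hχi : Integrable χ := hχL.continuous.integrable_of_hasCompactSupport hχs
  have hχF : ∀ ξ, Tendsto (fun j => 𝓕 (g j) ξ) atTop (𝓝 (𝓕 χ ξ)) := fun ξ => by
    simp_rw [Real.fourier_eq]
    refine tendsto_integral_of_dominated_convergence (V.indicator fun _ => 1) (fun j => ?_) ?_
      (fun j => .of_forall fun x => ?_) (.of_forall fun x => (hχ x).const_smul _)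
    · exact ((Real.fourierIntegral_convergent_iff ξ).2 (hgi j)).aestronglyMeasurable
    · exact (integrable_indicator_iff hVc.measurableSet).2
        (integrableOn_const hVc.measure_lt_top.ne)
    · rw [Circle.norm_smul]
      by_cases hx : x ∈ V
      · rw [Set.indicator_of_mem hx]; exact (hgL j).2 x
      · rw [Set.indicator_of_notMem hx, hg0 j x hx, norm_zero]
  -- Stages with `j < ω(|ξ|) - C` gain `e^{-1}`; later ones are only known not to lose.
  have hgF : ∀ ξ (j : ℕ), ‖𝓕 (g j) ξ‖ ≤
      ‖𝓕 f ξ‖ * Real.exp (-(min (j : ℝ) (ω ‖ξ‖ - C))) := fun ξ j => by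
    induction j with
    | zero =>
      refine le_mul_of_one_le_right (norm_nonneg _) (Real.one_le_exp ?_)
      simp
    | succ j ih =>
      rw [hgs, fourier_smear (hgL j).1.continuous (hgi j), norm_mul]
      rcases lt_or_ge (j : ℝ) (ω ‖ξ‖ - C) with hj | hj
      · have h1 := hμR (a j • ξ) (by
          rw [norm_smul, Real.norm_eq_abs, abs_of_nonneg (ha0 j)]
          exact haC _ (norm_nonneg ξ) j hj)
        refine (mul_le_mul ih h1 (norm_nonneg _) (by positivity)).trans ?_
        rw [mul_assoc, ← Real.exp_add, min_eq_left hj.le]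
        gcongr
        push_cast
        linarith [min_le_left ((j : ℝ) + 1) (ω ‖ξ‖ - C)]
      · have h1 : ‖∫ y, (Real.fourierChar (-inner ℝ y (a j • ξ)) : ℂ) ∂μ‖ ≤ 1 := by
          simpa using norm_integral_le_of_norm_le_const (μ := μ) (C := 1)
            (.of_forall fun y => (Circle.norm_coe _).le)
        refine (mul_le_mul ih h1 (norm_nonneg _) (by positivity)).trans ?_
        rw [mul_one, min_eq_right hj, min_eq_right (by push_cast; linarith)]
  have hFle : ∀ ξ, ‖𝓕 χ ξ‖ ≤ ‖𝓕 f ξ‖ * Real.exp (C - ω ‖ξ‖) := fun ξ => by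
    refine le_of_tendsto (hχF ξ).norm ?_
    obtain ⟨N, hN⟩ := exists_nat_ge (ω ‖ξ‖ - C)
    filter_upwards [eventually_ge_atTop N] with j hj
    have := hgF ξ j
    rwa [min_eq_right (hN.trans (by exact_mod_cast hj)), neg_sub] at this
  have hfS : ∀ k : ℕ, Integrable fun ξ => ‖ξ‖ ^ k * ‖𝓕 f ξ‖ := fun k =>
    (𝓕 (hfsupp.toSchwartzMap hf)).integrable_pow_mul volume k
  have hFle' : ∀ ξ, ‖𝓕 χ ξ‖ ≤ Real.exp C * ‖𝓕 f ξ‖ := fun ξ => by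
    refine (hFle ξ).trans ?_
    rw [mul_comm]
    gcongr
    linarith [ω.nonneg (norm_nonneg ξ)]
  have hFm : Continuous (𝓕 χ) := fourier_measurable hχi
  refine ⟨χ, contDiff_of_pow_mul_fourier hχL.continuous hχi fun k => ?_, hχs, ?_, ?_, hχK, hχ1⟩
  · refine ((hfS k).const_mul (Real.exp C)).mono' (by fun_prop) (.of_forall fun ξ => ?_)
    rw [Real.norm_of_nonneg (by positivity), mul_left_comm]
    gcongr
    exact hFle' ξ
  · refine (closure_minimal (fun x hx => ?_) Metric.isClosed_cthickening).trans hδU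
    by_contra hxV
    exact hx (hχ0 x hxV)
  · have h0 := ((hfS 0).const_mul (Real.exp C)).lintegral_lt_top
    refine lt_of_le_of_lt (lintegral_mono fun ξ => ?_) h0
    rw [← ofReal_norm, ← ENNReal.ofReal_mul (norm_nonneg _), pow_zero, one_mul]
    refine ENNReal.ofReal_le_ofReal ?_
    refine (mul_le_mul_of_nonneg_right (hFle ξ) (Real.exp_pos _).le).trans_eq ?_
    rw [mul_assoc, ← Real.exp_add, mul_comm, one_mul, sub_add_cancel]

/-! ### Parseval's formula and submultiplicativity of the weighted norms. -/

theorem integral_mul_eq_integral_fourier_mul {g h : Rn n → ℂ} (hgc : Continuous g)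
    (hg : Integrable g) (hgF : Integrable (𝓕 g)) (hh : Integrable h) :
    ∫ x, g x * h x = ∫ ζ, 𝓕 g (-ζ) * 𝓕 h ζ := by
  have h1 : g = 𝓕 (fun ξ => 𝓕 g (-ξ)) := by
    rw [← Real.fourierInv_eq_fourier_comp_neg, hgc.fourierInv_fourier_eq hg hgF]
  have h2 := VectorFourier.integral_fourierIntegral_smul_eq_flip (μ := volume) (ν := volume)
    (L := innerₗ (Rn n)) (f := fun ξ => 𝓕 g (-ξ)) (g := h) Real.continuous_fourierChar
    (by exact continuous_inner) hgF.comp_neg hh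
  rw [flip_innerₗ] at h2
  calc ∫ x, g x * h x = ∫ x, 𝓕 (fun ξ => 𝓕 g (-ξ)) x * h x := by rw [← h1]
    _ = _ := h2

/-- This is Parseval's formula for `g` and `f` modulated by the character of frequency `ξ`. -/
theorem fourier_mul {f g : Rn n → ℂ} (hf : Integrable f) (hgc : Continuous g)
    (hg : Integrable g) (hgF : Integrable (𝓕 g)) (ξ : Rn n) :
    𝓕 (f * g) ξ = ∫ ζ, 𝓕 g (-ζ) * 𝓕 f (ξ + ζ) := by
  have h := integral_mul_eq_integral_fourier_mul (h := fun x => Real.fourierChar (-inner ℝ x ξ) • f x)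
    hgc hg hgF ((Real.fourierIntegral_convergent_iff ξ).2 hf)
  calc 𝓕 (f * g) ξ = ∫ x, g x * (Real.fourierChar (-inner ℝ x ξ) • f x) := by
        rw [Real.fourier_eq]
        refine integral_congr_ae (.of_forall fun x => ?_)
        simp only [Pi.mul_apply, Circle.smul_def, smul_eq_mul]
        ring
    _ = _ := h
    _ = _ := by
        refine integral_congr_ae (.of_forall fun ζ => ?_)
        simp only
        congr 1
        rw [Real.fourier_eq, Real.fourier_eq]
        refine integral_congr_ae (.of_forall fun x => ?_)
        simp only [inner_add_right, neg_add, AddChar.map_add_eq_mul, mul_smul]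
        rw [smul_comm]

theorem measurable_weight_factor (τ : Weight) (l : ℝ) :
    Measurable fun ξ : Rn n => ENNReal.ofReal (Real.exp (l * τ ‖ξ‖)) :=
  (Real.continuous_exp.comp (continuous_const.mul τ.continuous_norm)).measurable.ennreal_ofReal

/-- Subadditivity of `τ` makes `e^{lτ(|ξ|)}` submultiplicative, so the bound is Young's inequality
in weighted `L¹` for the convolution of Fourier transforms. -/
theorem wnorm_mul_le (τ : Weight) {l : ℝ} (hl : 0 ≤ l) {f g : Rn n → ℂ} (hf : Integrable f)
    (hgc : Continuous g) (hg : Integrable g) (hgF : Integrable (𝓕 g)) :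
    wnorm τ l (f * g) ≤ wnorm τ l f * wnorm τ l g := by
  set w : Rn n → ℝ≥0∞ := fun ξ => ENNReal.ofReal (Real.exp (l * τ ‖ξ‖)) with hw
  have hwm : Measurable w := measurable_weight_factor τ l
  have hfm := (fourier_measurable hf).measurable.enorm
  have hgm := (fourier_measurable hg).measurable.enorm
  have hww : ∀ ξ ζ, w ξ ≤ w (-ζ) * w (ξ + ζ) := fun ξ ζ => by
    rw [hw, ← ENNReal.ofReal_mul (Real.exp_pos _).le, ← Real.exp_add, ← mul_add]
    refine ENNReal.ofReal_le_ofReal (Real.exp_le_exp.2 (mul_le_mul_of_nonneg_left ?_ hl))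
    have := τ.norm_le ξ (-ζ)
    rw [sub_neg_eq_add] at this
    linarith
  calc wnorm τ l (f * g)
      ≤ ∫⁻ ξ, ∫⁻ ζ, (‖𝓕 g (-ζ)‖ₑ * w (-ζ)) * (‖𝓕 f (ξ + ζ)‖ₑ * w (ξ + ζ)) := by
        refine lintegral_mono fun ξ => ?_
        rw [fourier_mul hf hgc hg hgF]
        refine (mul_le_mul_left (enorm_integral_le_lintegral_enorm _) _).trans ?_
        rw [← lintegral_mul_const' _ _ ENNReal.ofReal_ne_top]
        refine lintegral_mono fun ζ => ?_
        rw [enorm_mul, mul_mul_mul_comm]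
        gcongr
        exact hww ξ ζ
    _ = ∫⁻ ζ, ∫⁻ ξ, (‖𝓕 g (-ζ)‖ₑ * w (-ζ)) * (‖𝓕 f (ξ + ζ)‖ₑ * w (ξ + ζ)) := by
        refine lintegral_lintegral_swap (Measurable.aemeasurable ?_)
        have h1 : Measurable fun p : Rn n × Rn n => -p.2 := by fun_prop
        have h2 : Measurable fun p : Rn n × Rn n => p.1 + p.2 := by fun_prop
        exact ((hgm.comp h1).mul (hwm.comp h1)).mul ((hfm.comp h2).mul (hwm.comp h2))
    _ = ∫⁻ ζ, (‖𝓕 g (-ζ)‖ₑ * w (-ζ)) * wnorm τ l f := by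
        refine lintegral_congr fun ζ => ?_
        rw [lintegral_const_mul (f := fun ξ => ‖𝓕 f (ξ + ζ)‖ₑ * w (ξ + ζ)) _
            ((hfm.mul hwm).comp (measurable_add_const ζ)),
          lintegral_add_right_eq_self fun ξ => ‖𝓕 f ξ‖ₑ * w ξ]
        rfl
    _ = wnorm τ l f * wnorm τ l g := by
        rw [lintegral_mul_const (f := fun ζ => ‖𝓕 g (-ζ)‖ₑ * w (-ζ)) _
          ((hgm.mul hwm).comp measurable_neg), mul_comm]
        congr 1
        exact lintegral_neg_eq_self fun ζ => ‖𝓕 g ζ‖ₑ * w ζ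

/-! ### Dilated mollifiers. -/

/-- The function `η⁻ⁿ φ((x - a) / η)`. -/
noncomputable def dilate (φ : SchwartzMap (Rn n) ℂ) (η : ℝ) (a x : Rn n) : ℂ :=
  ((η : ℂ) ^ n)⁻¹ * φ (η⁻¹ • (x - a))

section dilate

variable (φ : SchwartzMap (Rn n) ℂ) {η : ℝ} (a : Rn n)

theorem contDiff_dilate (η : ℝ) : ContDiff ℝ (⊤ : ℕ∞) (dilate φ η a) :=
  contDiff_const.mul ((φ.smooth ⊤).comp ((contDiff_id.sub contDiff_const).const_smul η⁻¹))

theorem integrable_dilate (hη : 0 < η) : Integrable (dilate φ η a) :=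
  ((φ.integrable.comp_smul (inv_ne_zero hη.ne')).comp_sub_right a).const_mul _

theorem fourier_dilate (hη : 0 < η) (ξ : Rn n) :
    𝓕 (dilate φ η a) ξ = (Real.fourierChar (-inner ℝ a ξ) : ℂ) * 𝓕 (φ : Rn n → ℂ) (η • ξ) := by
  have h1 := Measure.integral_comp_smul volume
    (fun y : Rn n => Real.fourierChar (-inner ℝ y (η • ξ)) • φ y) η⁻¹
  rw [finrank_euclideanSpace_fin, inv_pow, inv_inv, abs_of_pos (by positivity),
    ← Real.fourier_eq (φ : Rn n → ℂ)] at h1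
  have hηC : (η : ℂ) ≠ 0 := by exact_mod_cast hη.ne'
  rw [Real.fourier_eq, ← integral_add_right_eq_self _ a]
  calc _ = ∫ x, ((Real.fourierChar (-inner ℝ a ξ) : ℂ) * ((η : ℂ) ^ n)⁻¹) *
        (Real.fourierChar (-inner ℝ (η⁻¹ • x) (η • ξ)) • φ (η⁻¹ • x)) := by
        refine integral_congr_ae (.of_forall fun x => ?_)
        simp only [dilate, add_sub_cancel_right, inner_add_left, neg_add, AddChar.map_add_eq_mul,
          Circle.smul_def, Circle.coe_mul, smul_eq_mul]
        rw [inner_smul_left, inner_smul_right, conj_trivial, inv_mul_cancel_left₀ hη.ne']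
        ring
    _ = _ := by
        rw [integral_const_mul, h1, Complex.real_smul]
        push_cast
        field_simp

theorem lintegral_fourier_dilate (hη : 0 < η) :
    ∫⁻ ξ, ‖𝓕 (φ : Rn n → ℂ) (η • ξ)‖ₑ =
      ENNReal.ofReal ((η ^ n)⁻¹) * ∫⁻ ξ, ‖𝓕 (φ : Rn n → ℂ) ξ‖ₑ := by
  have hm : Measurable fun ξ => ‖𝓕 (φ : Rn n → ℂ) ξ‖ₑ :=
    (fourier_measurable φ.integrable).measurable.enorm
  rw [← lintegral_map (f := fun ξ => ‖𝓕 (φ : Rn n → ℂ) ξ‖ₑ) hm (measurable_const_smul η),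
    Measure.map_addHaar_smul _ hη.ne', lintegral_smul_measure, finrank_euclideanSpace_fin,
    abs_of_pos (by positivity), smul_eq_mul]

theorem lintegral_fourier_lt_top : ∫⁻ ξ, ‖𝓕 (φ : Rn n → ℂ) ξ‖ₑ < ∞ :=
  (𝓕 φ).integrable.hasFiniteIntegral

theorem integrable_fourier_dilate (hη : 0 < η) : Integrable (𝓕 (dilate φ η a)) := by
  refine ⟨(fourier_measurable (integrable_dilate φ a hη)).aestronglyMeasurable, ?_⟩
  refine lt_of_eq_of_lt (lintegral_congr fun ξ => ?_) ((lintegral_fourier_dilate φ hη).trans_lt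
    (ENNReal.mul_lt_top ENNReal.ofReal_lt_top (lintegral_fourier_lt_top φ)))
  rw [fourier_dilate φ a hη, enorm_mul, ← ofReal_norm, Circle.norm_coe, ENNReal.ofReal_one,
    one_mul]

/-- On the support of `φ̂(ηξ)` one has `|ξ| ≤ R/η`, hence `τ(|ξ|) ≤ ⌈R⌉ τ(1/η)`; the change of
variables costs `η^{-n} ≤ (1 + 1/η)^n`. The constants serve all `τ`, `l` and `η` at once. -/
theorem exists_wnorm_dilate_le (hφ : HasCompactSupport (𝓕 (φ : Rn n → ℂ))) :
    ∃ (M : ℝ≥0∞) (m : ℕ), M ≠ ∞ ∧ ∀ (τ : Weight) (l η : ℝ), 0 ≤ l → 0 < η →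
      wnorm τ l (dilate φ η a) ≤
        M * ENNReal.ofReal (Real.exp (n * Real.log (1 + 1 / η) + l * (m * τ (1 / η)))) := by
  obtain ⟨R, hR0, hR⟩ := hφ.isCompact.isBounded.exists_pos_norm_le
  refine ⟨∫⁻ ξ, ‖𝓕 (φ : Rn n → ℂ) ξ‖ₑ, ⌈R⌉₊, (lintegral_fourier_lt_top φ).ne,
    fun τ l η hl hη => ?_⟩
  have h1 : wnorm τ l (dilate φ η a) ≤ ∫⁻ ξ, ‖𝓕 (φ : Rn n → ℂ) (η • ξ)‖ₑ *
      ENNReal.ofReal (Real.exp (l * (⌈R⌉₊ * τ (1 / η)))) := by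
    refine lintegral_mono fun ξ => ?_
    rw [fourier_dilate φ a hη, enorm_mul, ← ofReal_norm (Real.fourierChar _ : ℂ), Circle.norm_coe,
      ENNReal.ofReal_one, one_mul]
    by_cases hξ : 𝓕 (φ : Rn n → ℂ) (η • ξ) = 0
    · simp [hξ]
    · have h2 := hR _ (subset_tsupport _ hξ)
      rw [norm_smul, Real.norm_eq_abs, abs_of_pos hη] at h2
      gcongr
      refine (τ.mono (Set.mem_Ici.2 (norm_nonneg ξ)) (Set.mem_Ici.2 (by positivity)) ?_).trans
        (τ.mul_le hR0.le (one_div_nonneg.2 hη.le))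
      rwa [mul_one_div, le_div_iff₀ hη, mul_comm]
  refine h1.trans ?_
  rw [lintegral_mul_const' _ _ ENNReal.ofReal_ne_top, lintegral_fourier_dilate φ hη, Real.exp_add,
    ENNReal.ofReal_mul (Real.exp_pos _).le, mul_comm (ENNReal.ofReal _) (∫⁻ _, _), mul_assoc]
  gcongr
  rw [mul_comm, Real.exp_mul, Real.exp_log (by positivity), Real.rpow_natCast, ← inv_pow, one_div]
  gcongr
  linarith

theorem dilate_mem_ultraFn (ω : Weight) (Ω : TopologicalSpace.Opens (Rn n))
    (hφ : HasCompactSupport (𝓕 (φ : Rn n → ℂ))) (hη : 0 < η) : dilate φ η a ∈ ultraFn ω Ω := by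
  refine ⟨(contDiff_dilate φ a η).contDiffOn, ?_⟩
  rintro χ ⟨h1, h2, h3, l, hl, h4⟩
  refine ⟨h1.mul (contDiff_dilate φ a η), h2.mul_right, tsupport_mul_subset_left.trans h3, l, hl,
    ?_⟩
  obtain ⟨M, m, hM, h5⟩ := exists_wnorm_dilate_le φ a hφ
  refine (wnorm_mul_le ω hl.le (h1.continuous.integrable_of_hasCompactSupport h2)
    (contDiff_dilate φ a η).continuous (integrable_dilate φ a hη)
    (integrable_fourier_dilate φ a hη)).trans_lt (ENNReal.mul_lt_top h4 ?_)
  exact (h5 ω l η hl.le hη).trans_lt (ENNReal.mul_lt_top hM.lt_top ENNReal.ofReal_lt_top)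

end dilate

/-! ### Moderateness and regularity of the slowed net. -/

theorem isLittleOExp_of_le {τ : Weight} {c : ℝ} {N : Eps → ℝ≥0∞} {M : ℝ≥0∞} (hM : M ≠ ∞)
    {B : Eps → ℝ} (hN : ∀ ε, N ε ≤ M * ENNReal.ofReal (Real.exp (B ε)))
    (hB : Tendsto (fun ε : Eps => c * τ (1 / (ε : ℝ)) - B ε) epsZero atTop) :
    IsLittleOExp τ c N := by
  have h1 := ENNReal.Tendsto.const_mul (a := M)
    (ENNReal.tendsto_ofReal (Real.tendsto_exp_neg_atTop_nhds_zero.comp hB)) (.inr hM)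
  rw [ENNReal.ofReal_zero, mul_zero] at h1
  refine tendsto_of_tendsto_of_tendsto_of_le_of_le tendsto_const_nhds h1
    (fun _ => zero_le) fun ε => ?_
  refine (mul_le_mul_left (hN ε) _).trans_eq ?_
  rw [mul_assoc, ← ENNReal.ofReal_mul (Real.exp_pos _).le, ← Real.exp_add, Function.comp]
  congr 3
  ring

theorem exists_testFn_cutoff (ω : Weight) {Ω : TopologicalSpace.Opens (Rn n)} {K : Set (Rn n)}
    (hK : IsCompact K) (hKΩ : K ⊆ Ω) :
    ∃ χ ∈ testFn ω Ω, Integrable χ ∧ wnorm ω 1 χ ≠ ∞ ∧ ∀ x ∈ K, χ x = 1 := by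
  obtain ⟨χ, h1, h2, h3, h4, h5, -⟩ := exists_cutoff ω hK Ω.isOpen hKΩ
  exact ⟨χ, ⟨h1, h2, h3, 1, one_pos, h4⟩, h1.continuous.integrable_of_hasCompactSupport h2, h4.ne,
    h5⟩

section slowedNet

variable {ω ω₁ : Weight} {Ω : TopologicalSpace.Opens (Rn n)} {φ : SchwartzMap (Rn n) ℂ}
  {η : Eps → ℝ} (a : Rn n)

theorem exists_locNorm_slowedNet_le (hφ : HasCompactSupport (𝓕 (φ : Rn n → ℂ)))
    (hη : ∀ ε, 0 < η ε) {K : Set (Rn n)} (hK : IsCompact K) (hKΩ : K ⊆ Ω)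
    {τ : Weight} {C : ℝ} (hτ : ∀ t, 0 ≤ t → τ t ≤ ω t + C) :
    ∃ (M : ℝ≥0∞) (m : ℕ), M ≠ ∞ ∧ ∀ ε, locNorm ω Ω τ 1 K (slowedNet φ η a ε) ≤
      M * ENNReal.ofReal (Real.exp (n * Real.log (1 + 1 / η ε) + m * τ (1 / η ε))) := by
  obtain ⟨χ, hχ, hχi, hχn, hχ1⟩ := exists_testFn_cutoff ω hK hKΩ
  obtain ⟨M, m, hM, h⟩ := exists_wnorm_dilate_le φ a hφ
  have hχτ : wnorm τ 1 χ ≤ ENNReal.ofReal (Real.exp C) * wnorm ω 1 χ := by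
    rw [wnorm, wnorm, ← lintegral_const_mul' _ _ ENNReal.ofReal_ne_top]
    refine lintegral_mono fun ξ => ?_
    rw [mul_left_comm, ← ENNReal.ofReal_mul (Real.exp_pos _).le, ← Real.exp_add]
    gcongr
    linarith [hτ ‖ξ‖ (norm_nonneg ξ)]
  refine ⟨ENNReal.ofReal (Real.exp C) * wnorm ω 1 χ * M, m,
    ENNReal.mul_ne_top (ENNReal.mul_ne_top ENNReal.ofReal_ne_top hχn) hM, fun ε => ?_⟩
  refine (iInf₂_le χ ⟨hχ, hχ1⟩).trans ((wnorm_mul_le τ zero_le_one hχi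
    (contDiff_dilate φ a (η ε)).continuous (integrable_dilate φ a (hη ε))
    (integrable_fourier_dilate φ a (hη ε))).trans ?_)
  rw [mul_assoc (_ * _)]
  refine mul_le_mul' hχτ ?_
  simpa only [one_mul] using h τ 1 (η ε) zero_le_one (hη ε)

theorem isLittleOExp_slowedNet (hφ : HasCompactSupport (𝓕 (φ : Rn n → ℂ)))
    (hω₁ : StrongLT ω₁ ω) (hη : IsSlowing ω ω₁ η) {K : Set (Rn n)} (hK : IsCompact K)
    (hKΩ : K ⊆ Ω) {k : ℝ} (hk : 0 < k) :
    IsLittleOExp ω k fun ε => locNorm ω Ω ω 1 K (slowedNet φ η a ε) := by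
  obtain ⟨M, m, hM, h⟩ := exists_locNorm_slowedNet_le a hφ (fun ε => (hη ε).1) hK hKΩ
    (τ := ω) (fun t _ => (add_zero (ω t)).ge)
  refine isLittleOExp_of_le hM h ?_
  -- The logarithm costs one more `ω(1/η)`; the total `(1 + m) ω(1/η) = (1 + m) ω₁(1/ε)` is then at
  -- most `(k/2) ω(1/ε)` up to a constant.
  obtain ⟨C₁, -, h1⟩ := ω.mul_log_le_mul_add n.cast_nonneg one_pos
  obtain ⟨C₂, -, h2⟩ := hω₁.mul_le_mul_add (m := 1 + m) (by positivity) (half_pos hk)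
  refine tendsto_atTop_mono (fun ε => ?_)
    (tendsto_atTop_add_const_right _ (-(C₁ + C₂)) (ω.tendsto_epsZero.const_mul_atTop (half_pos hk)))
  have h3 := h1 _ (one_div_nonneg.2 (hη ε).1.le)
  have h4 := h2 _ (one_div_nonneg.2 ε.2.1.le)
  rw [← (hη ε).2] at h3 ⊢
  linarith

theorem isModerate_slowedNet (hφ : HasCompactSupport (𝓕 (φ : Rn n → ℂ)))
    (hω₁ : StrongLT ω₁ ω) (hη : IsSlowing ω ω₁ η) : IsModerate ω Ω (slowedNet φ η a) :=
  ⟨fun ε => dilate_mem_ultraFn φ a ω Ω hφ (hη ε).1, fun _ hK hKΩ _ hk =>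
    ⟨1, one_pos, isLittleOExp_slowedNet a hφ hω₁ hη hK hKΩ hk⟩⟩

theorem isRegularNet_slowedNet (hφ : HasCompactSupport (𝓕 (φ : Rn n → ℂ)))
    (hω₁ : StrongLT ω₁ ω) (hη : IsSlowing ω ω₁ η) : IsRegularNet ω Ω (slowedNet φ η a) :=
  ⟨isModerate_slowedNet a hφ hω₁ hη, fun _ hK hKΩ => ⟨1, one_pos, fun _ hk =>
    isLittleOExp_slowedNet a hφ hω₁ hη hK hKΩ hk⟩⟩

theorem isRegularNetProj_slowedNet (hφ : HasCompactSupport (𝓕 (φ : Rn n → ℂ)))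
    (hω₁ : StrongLT ω₁ ω) (hη : IsSlowing ω ω₁ η) : IsRegularNetProj ω Ω (slowedNet φ η a) := by
  refine ⟨isModerate_slowedNet a hφ hω₁ hη, fun K hK hKΩ => ⟨ω₁, hω₁, fun ω₂ hω₂ => ?_⟩⟩
  obtain ⟨C₀, -, h0⟩ := hω₂.mul_le_mul_add zero_le_one one_pos
  simp only [one_mul] at h0
  obtain ⟨M, m, hM, h⟩ := exists_locNorm_slowedNet_le a hφ (fun ε => (hη ε).1) hK hKΩ h0
  refine isLittleOExp_of_le hM h ?_
  -- Two quarters of `ω(1/η) = ω₁(1/ε)` bound the exponent, leaving half of `ω₁(1/ε)` to tend to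
  -- infinity.
  obtain ⟨C₁, -, h1⟩ := ω.mul_log_le_mul_add n.cast_nonneg (c := 1 / 4) (by norm_num)
  obtain ⟨C₂, -, h2⟩ := hω₂.mul_le_mul_add m.cast_nonneg (c := 1 / 4) (by norm_num)
  refine tendsto_atTop_mono (fun ε => ?_) (tendsto_atTop_add_const_right _ (-(C₁ + C₂))
    (ω₁.tendsto_epsZero.const_mul_atTop one_half_pos))
  have h3 := h1 _ (one_div_nonneg.2 (hη ε).1.le)
  have h4 := h2 _ (one_div_nonneg.2 (hη ε).1.le)
  rw [← (hη ε).2] at h3 h4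
  linarith

end slowedNet

/-! ### Pairings with test functions and strong association. -/

variable {ω ω₁ : Weight} {Ω : TopologicalSpace.Opens (Rn n)}

theorem integrable_of_mem_testFn {f : Rn n → ℂ} (hf : f ∈ testFn ω Ω) : Integrable f :=
  hf.1.continuous.integrable_of_hasCompactSupport hf.2.1

theorem integrable_ultraFn_mul {u : Rn n → ℂ} (hu : u ∈ ultraFn ω Ω) (ρ : testFn ω Ω) :
    Integrable fun x => u x * (ρ : Rn n → ℂ) x := by
  simp_rw [mul_comm (u _)]
  exact integrable_of_mem_testFn (hu.2 ρ ρ.2)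

/-- On the support of `ρ`, `w` agrees with `χ w`, whose sup norm is at most its weighted Fourier
norm. Requiring `D ≠ 0` allows division before the infimum over `χ` and avoids `∞ * 0`. -/
theorem enorm_integral_mul_le_locNorm {w : Rn n → ℂ} (hw : w ∈ ultraFn ω Ω) (τ : Weight) {h : ℝ}
    (hh : 0 < h) {K : Set (Rn n)} {ρ : Rn n → ℂ} (hρ : tsupport ρ ⊆ K) {D : ℝ≥0∞} (hD0 : D ≠ 0)
    (hD : D ≠ ∞) (hρD : ∫⁻ x, ‖ρ x‖ₑ ≤ D) :
    ‖∫ x, w x * ρ x‖ₑ ≤ locNorm ω Ω τ h K w * D := by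
  rw [← ENNReal.div_le_iff hD0 hD]
  refine le_iInf₂ fun χ ⟨hχ, hχ1⟩ => ?_
  rw [ENNReal.div_le_iff hD0 hD]
  have hχw := hw.2 χ hχ
  refine (enorm_integral_le_lintegral_enorm _).trans ?_
  calc ∫⁻ x, ‖w x * ρ x‖ₑ ≤ ∫⁻ x, wnorm τ h (χ * w) * ‖ρ x‖ₑ := by
        refine lintegral_mono fun x => ?_
        by_cases hx : x ∈ tsupport ρ
        · have h1 := enorm_apply_le_wnorm τ hh hχw.1.continuous (integrable_of_mem_testFn hχw) x
          rw [Pi.mul_apply, hχ1 x (hρ hx), one_mul] at h1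
          rw [enorm_mul]
          gcongr
        · simp [image_eq_zero_of_notMem_tsupport hx]
    _ ≤ wnorm τ h (χ * w) * D := by
        by_cases hfin : wnorm τ h (χ * w) = ∞
        · rw [hfin, ENNReal.top_mul hD0]
          exact le_top
        · rw [lintegral_const_mul' _ _ hfin]
          gcongr

theorem IsNegligible.integral_isLittleO {w : Net n} (hw : IsNegligible ω Ω w)
    {K : Set (Rn n)} (hK : IsCompact K) (hKΩ : K ⊆ Ω) (hω₁ : StrongLT ω₁ ω)
    {ρ : Rn n → ℂ} (hρi : Integrable ρ) (hρ : tsupport ρ ⊆ K) :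
    (fun ε => ∫ x, w ε x * ρ x)
      =o[epsZero] fun ε : Eps => Real.exp (-(ω₁ (1 / (ε : ℝ)))) := by
  obtain ⟨k, hk, h, hh, hlim⟩ := hw.2 K hK hKΩ
  refine IsBigO.trans_isLittleO (IsBigO.of_bound ((∫⁻ x, ‖ρ x‖ₑ) + 1).toReal ?_)
    (hω₁.exp_isLittleO hk)
  have hD : (∫⁻ x, ‖ρ x‖ₑ) + 1 ≠ ∞ := ENNReal.add_ne_top.2 ⟨hρi.hasFiniteIntegral.ne, by simp⟩
  filter_upwards [hlim.eventually_le_const one_pos] with ε hε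
  have hexp := Real.exp_pos (k * ω (1 / (ε : ℝ)))
  have h1 := enorm_integral_mul_le_locNorm (hw.1 ε) ω hh hρ (by simp) hD le_self_add
  rw [neg_mul, neg_neg] at hε
  have h2 : locNorm ω Ω ω h K (w ε) ≤ ENNReal.ofReal (Real.exp (-(k * ω (1 / (ε : ℝ))))) := by
    rw [Real.exp_neg, ENNReal.ofReal_inv_of_pos hexp]
    exact ENNReal.le_inv_iff_mul_le.2 hε
  have h3 := ENNReal.toReal_mono (ENNReal.mul_ne_top ENNReal.ofReal_ne_top hD)
    (h1.trans (mul_le_mul_left h2 _))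
  rw [ENNReal.toReal_mul, ENNReal.toReal_ofReal (Real.exp_pos _).le, toReal_enorm, mul_comm] at h3
  rwa [Real.norm_of_nonneg (Real.exp_pos _).le]

theorem NetStronglyAssociated.congr {T : Ultradistribution ω Ω} {u v : Net n}
    (hT : NetStronglyAssociated T u) (hu : ∀ ε, u ε ∈ ultraFn ω Ω) (hv : ∀ ε, v ε ∈ ultraFn ω Ω)
    (huv : ∀ K : Set (Rn n), IsCompact K → K ⊆ Ω → ∀ ω₁ : Weight, StrongLT ω₁ ω →
      ∀ ρ : testFn ω Ω, tsupport (ρ : Rn n → ℂ) ⊆ K →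
        (fun ε => ∫ x, (v - u) ε x * (ρ : Rn n → ℂ) x)
          =o[epsZero] fun ε : Eps => Real.exp (-(ω₁ (1 / (ε : ℝ))))) :
    NetStronglyAssociated T v := by
  intro K hK hKΩ
  obtain ⟨ωb, hωb, h⟩ := hT K hK hKΩ
  refine ⟨ωb, hωb, fun ρ hρ => ((h ρ hρ).add (huv K hK hKΩ ωb hωb ρ hρ)).congr_left fun ε => ?_⟩
  simp only [Pi.sub_apply, sub_mul]
  rw [integral_sub (integrable_ultraFn_mul (hv ε) ρ) (integrable_ultraFn_mul (hu ε) ρ)]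
  ring

theorem NetStronglyAssociated.stronglyAssociated {T : Ultradistribution ω Ω} {u : Net n}
    (hT : NetStronglyAssociated T u) (hu : IsModerate ω Ω u) :
    StronglyAssociated T (GenFn.mk u hu) := by
  intro v hv hvu
  -- Association is invariant under the generating relation, so it descends to the quotient; no
  -- proof that the relation is an equivalence is needed.
  have hiff := congrArg (Quot.lift
    (fun w : {w : Net n // IsModerate ω Ω w} => NetStronglyAssociated T w.1) fun w w' hww' => by
      refine propext ⟨fun h => h.congr w.2.1 w'.2.1 fun K hK hKΩ ω₁ hω₁ ρ hρ => ?_,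
        fun h => h.congr w'.2.1 w.2.1 fun K hK hKΩ ω₁ hω₁ ρ hρ =>
          hww'.integral_isLittleO hK hKΩ hω₁ (integrable_of_mem_testFn ρ.2) hρ⟩
      refine (hww'.integral_isLittleO hK hKΩ hω₁ (integrable_of_mem_testFn ρ.2)
        hρ).neg_left.congr_left fun ε => ?_
      rw [← integral_neg]
      simp only [Pi.sub_apply, ← neg_mul, neg_sub]) hvu
  exact hiff.mpr hT

theorem Weight.integrable_fourier_mul_exp (ω : Weight) {l : ℝ} {ρ : Rn n → ℂ} (hρ : Integrable ρ)
    (h : wnorm ω l ρ < ∞) : Integrable fun ξ => ‖𝓕 ρ ξ‖ * Real.exp (l * ω ‖ξ‖) := by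
  refine ⟨((fourier_measurable hρ).norm.mul
    (Real.continuous_exp.comp (continuous_const.mul ω.continuous_norm))).aestronglyMeasurable, ?_⟩
  refine lt_of_eq_of_lt (lintegral_congr fun ξ => ?_) h
  rw [enorm_mul, enorm_norm, Real.enorm_of_nonneg (Real.exp_pos _).le]

theorem netStronglyAssociated_slowedNet {φ : SchwartzMap (Rn n) ℂ} (hφ : IsMollifier φ)
    (hω₁ : StrongLT ω₁ ω) {η : Eps → ℝ} (hη : IsSlowing ω ω₁ η) (a : Rn n) :
    NetStronglyAssociated (dirac ω Ω a) (slowedNet φ η a) := by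
  intro K hK hKΩ
  -- The decay obtained below is `e^{-cω₁(1/ε)}` with `c` depending on `ρ`; a weight `ωb` far below
  -- `ω₁` absorbs every such `c` uniformly.
  obtain ⟨ωb, hωb⟩ := exists_strongLT ω₁
  refine ⟨ωb, hωb.trans hω₁, fun ρ _ => ?_⟩
  obtain ⟨r, hr, hr1⟩ := Metric.eventually_nhds_iff.1 hφ.2
  obtain ⟨A, hA⟩ := hφ.1.exists_bound_of_continuous (fourier_measurable φ.integrable)
  have hρi := integrable_of_mem_testFn ρ.2
  obtain ⟨hρ1, -, -, l, hl, hρl⟩ := ρ.2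
  set F := 𝓕 (ρ : Rn n → ℂ) with hF
  have hint := ω.integrable_fourier_mul_exp hρi hρl
  have hFi : Integrable F := ⟨(fourier_measurable hρi).aestronglyMeasurable,
    (lintegral_fourier_le_wnorm ω hl.le _).trans_lt hρl⟩
  have hm : 0 < (⌈1 / r⌉₊ : ℝ) := by exact_mod_cast Nat.ceil_pos.2 (one_div_pos.2 hr)
  refine IsBigO.trans_isLittleO (IsBigO.of_bound
    ((A + 1) * ∫ ξ, ‖F ξ‖ * Real.exp (l * ω ‖ξ‖)) (.of_forall fun ε => ?_))
    (hωb.exp_isLittleO (div_pos hl hm))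
  obtain ⟨hε, hεω⟩ := hη ε
  have hdelta : (dirac ω Ω a).toLin ρ = ∫ ξ, (Real.fourierChar (inner ℝ ξ a) : ℂ) * F ξ := by
    change (ρ : Rn n → ℂ) a = _
    rw [← congrFun (hρ1.continuous.fourierInv_fourier_eq hρi hFi) a, Real.fourierInv_eq]
    rfl
  have hnet : ∫ x, slowedNet φ η a ε x * (ρ : Rn n → ℂ) x =
      ∫ ξ, 𝓕 (dilate φ (η ε) a) (-ξ) * F ξ :=
    integral_mul_eq_integral_fourier_mul (contDiff_dilate φ a (η ε)).continuous
      (integrable_dilate φ a hε) (integrable_fourier_dilate φ a hε) hρi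
  have hi1 : Integrable fun ξ => (Real.fourierChar (inner ℝ ξ a) : ℂ) * F ξ := by
    have := (Real.fourierIntegral_convergent_iff (-a)).2 hFi
    simpa only [inner_neg_right, neg_neg] using! this
  have hi2 : Integrable fun ξ => 𝓕 (dilate φ (η ε) a) (-ξ) * F ξ := by
    refine hFi.bdd_mul (c := A) ((fourier_measurable
      (integrable_dilate φ a hε)).comp continuous_neg).aestronglyMeasurable (.of_forall fun ξ => ?_)
    rw [fourier_dilate φ a hε, norm_mul, Circle.norm_coe, one_mul]
    exact hA _
  rw [hdelta, hnet, ← integral_sub hi2 hi1, Real.norm_of_nonneg (Real.exp_pos _).le,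
    mul_right_comm, ← integral_const_mul]
  refine norm_integral_le_of_norm_le (hint.const_mul _) (.of_forall fun ξ => ?_)
  have hA0 : 0 ≤ A := (norm_nonneg _).trans (hA 0)
  rw [fourier_dilate φ a hε, inner_neg_right, neg_neg, real_inner_comm, mul_assoc, ← mul_sub,
    norm_mul, Circle.norm_coe, one_mul, smul_neg, ← sub_one_mul, norm_mul]
  -- Low frequencies see `φ̂ = 1`. At high ones `1/η ≤ |ξ|/r`, so `ω₁(1/ε) = ω(1/η) ≤ ⌈1/r⌉ ω(|ξ|)`.
  by_cases hξ : η ε * ‖ξ‖ < r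
  · rw [hr1 (by rwa [dist_zero_right, norm_neg, norm_smul, Real.norm_of_nonneg hε.le]), sub_self,
      norm_zero, zero_mul]
    positivity
  · have h1 : ‖𝓕 (φ : Rn n → ℂ) (-(η ε • ξ)) - 1‖ ≤ A + 1 :=
      (norm_sub_le _ _).trans (by rw [norm_one]; gcongr; exact hA _)
    have h2 : l / ⌈1 / r⌉₊ * ω₁ (1 / (ε : ℝ)) ≤ l * ω ‖ξ‖ := by
      rw [hεω, div_mul_eq_mul_div, div_le_iff₀ hm, mul_assoc]
      refine mul_le_mul_of_nonneg_left ?_ hl.le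
      rw [mul_comm]
      refine (ω.mono (Set.mem_Ici.2 (by positivity)) (Set.mem_Ici.2 (by positivity)) ?_).trans
        (ω.mul_le (one_div_pos.2 hr).le (norm_nonneg ξ))
      rw [one_div_mul_eq_div, div_le_div_iff₀ hε hr]
      linarith
    have h3 : 1 ≤ Real.exp (-(l / ⌈1 / r⌉₊ * ω₁ (1 / (ε : ℝ)))) * Real.exp (l * ω ‖ξ‖) := by
      rw [← Real.exp_add]
      exact Real.one_le_exp (by linarith)
    rw [mul_assoc, mul_left_comm _ ‖F ξ‖]
    exact mul_le_mul h1 (le_mul_of_one_le_right (norm_nonneg _) h3) (norm_nonneg _) (by positivity)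

/-! ### Existence of mollifiers and irregularity of the delta. -/

theorem exists_isMollifier (n : ℕ) : ∃ φ : SchwartzMap (Rn n) ℂ, IsMollifier φ := by
  obtain ⟨f, hf, -, hf1, hf0⟩ := exists_contDiff_one_zero (K := {(0 : Rn n)}) one_pos
  have hfs : HasCompactSupport f :=
    HasCompactSupport.intro ((isCompact_singleton (x := (0 : Rn n))).cthickening (r := 2 * 1)) hf0
  refine ⟨𝓕⁻ (hfs.toSchwartzMap hf), ?_⟩
  have h : 𝓕 ((𝓕⁻ (hfs.toSchwartzMap hf) : SchwartzMap (Rn n) ℂ) : Rn n → ℂ) = f := by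
    rw [← SchwartzMap.fourier_coe, FourierTransform.fourier_fourierInv_eq]
    rfl
  rw [IsMollifier, h]
  refine ⟨hfs, ?_⟩
  filter_upwards [Metric.closedBall_mem_nhds (0 : Rn n) one_pos] with ξ hξ
  exact hf1 ξ (Metric.mem_cthickening_of_dist_le ξ 0 1 _ rfl hξ)

/-- A density `f` would be bounded by `C` near `a`. Testing against a cutoff `χ` with `χ(a) = 1`,
`|χ| ≤ 1` and support in a set of volume below `1/C` gives `1 = |∫ f χ| < 1`. -/
theorem not_isUltradifferentiable_dirac (hn : 0 < n) {a : Rn n} (ha : a ∈ Ω) :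
    ¬ (dirac ω Ω a).IsUltradifferentiable := by
  rintro ⟨f, ⟨hf, -⟩, hfρ⟩
  -- Positive dimension makes `{a}` a null set; for `n = 0` the delta is integration against the
  -- constant `1`.
  have : Nonempty (Fin n) := ⟨⟨0, hn⟩⟩
  have hΩ : (Ω : Set (Rn n)) ∈ 𝓝 a := Ω.isOpen.mem_nhds ha
  set C : ℝ≥0 := ‖f a‖₊ + 1
  have hC : (C : ℝ≥0∞) ≠ 0 := by simp [C]
  have hev : ∀ᶠ x in 𝓝 a, x ∈ Ω ∧ ‖f x‖₊ < C :=
    (Filter.eventually_of_mem hΩ fun _ h => h).and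
      ((hf.continuousOn.continuousAt hΩ).nnnorm.eventually_lt_const (lt_add_one _))
  obtain ⟨U, hU, hUo, haU⟩ := eventually_nhds_iff.1 hev
  obtain ⟨V, haV, hVo, hV⟩ := ({a} : Set (Rn n)).exists_isOpen_lt_of_lt (μ := volume)
    (C : ℝ≥0∞)⁻¹ (by simp)
  obtain ⟨χ, h1, h2, h3, h4, h5, h6⟩ := exists_cutoff ω (isCompact_singleton (x := a))
    (hUo.inter hVo) (Set.singleton_subset_iff.2 ⟨haU, haV rfl⟩)
  have hχ : χ ∈ testFn ω Ω :=
    ⟨h1, h2, h3.trans fun x hx => (hU x hx.1).1, 1, one_pos, h4⟩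
  have h7 : (1 : ℂ) = ∫ x, f x * χ x := by
    rw [← h5 a rfl]
    exact hfρ ⟨χ, hχ⟩
  have h8 : (1 : ℝ≥0∞) ≤ C * volume V := by
    calc (1 : ℝ≥0∞) = ‖∫ x, f x * χ x‖ₑ := by rw [← h7, enorm_one]
      _ ≤ ∫⁻ x, ‖f x * χ x‖ₑ := enorm_integral_le_lintegral_enorm _
      _ ≤ ∫⁻ x, V.indicator (fun _ => (C : ℝ≥0∞)) x := by
          refine lintegral_mono fun x => ?_
          by_cases hx : x ∈ tsupport χ
          · rw [Set.indicator_of_mem (h3 hx).2, enorm_mul, ← mul_one (C : ℝ≥0∞)]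
            refine mul_le_mul' (ENNReal.coe_le_coe.2 (hU x (h3 hx).1).2.le) ?_
            exact ENNReal.coe_le_coe.2 (h6 x)
          · simp [image_eq_zero_of_notMem_tsupport hx]
      _ = C * volume V := lintegral_indicator_const hVo.measurableSet _
  refine h8.not_gt ?_
  rw [mul_comm]
  exact (ENNReal.lt_div_iff_mul_lt (.inl hC) (.inl ENNReal.coe_ne_top)).1 (by rwa [one_div])

end Roumieu

theorem mainTheorem3 (n : ℕ) (hn : 0 < n) (ω : Roumieu.Weight)
    (Ω : TopologicalSpace.Opens (Roumieu.Rn n)) (a : Roumieu.Rn n) (ha : a ∈ Ω) :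
    (∃ (T : Roumieu.Ultradistribution ω Ω) (g : Roumieu.GenFn ω Ω),
      ¬ T.IsUltradifferentiable ∧ g.IsRegular ∧ Roumieu.StronglyAssociated T g) ∧
    ¬ (Roumieu.dirac ω Ω a).IsUltradifferentiable ∧
    (∃ φ : SchwartzMap (Roumieu.Rn n) ℂ, Roumieu.IsMollifier φ) ∧
    (∃ ω₁ : Roumieu.Weight, Roumieu.StrongLT ω₁ ω) ∧
    ∀ φ : SchwartzMap (Roumieu.Rn n) ℂ, Roumieu.IsMollifier φ →
      ∀ ω₁ : Roumieu.Weight, Roumieu.StrongLT ω₁ ω →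
        (∃ η : Roumieu.Eps → ℝ, Roumieu.IsSlowing ω ω₁ η) ∧
        ∀ η : Roumieu.Eps → ℝ, Roumieu.IsSlowing ω ω₁ η →
          ∃ hu : Roumieu.IsModerate ω Ω (Roumieu.slowedNet φ η a),
            (Roumieu.GenFn.mk (Roumieu.slowedNet φ η a) hu).IsRegular ∧
            (Roumieu.GenFn.mk (Roumieu.slowedNet φ η a) hu).IsRegularProj ∧
            Roumieu.StronglyAssociated (Roumieu.dirac ω Ω a) (Roumieu.GenFn.mk (Roumieu.slowedNet φ η a) hu) := by
  have hdirac := Roumieu.not_isUltradifferentiable_dirac (ω := ω) hn ha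
  obtain ⟨φ, hφ⟩ := Roumieu.exists_isMollifier n
  obtain ⟨ω₁, hω₁⟩ := Roumieu.exists_strongLT ω
  obtain ⟨η, hη⟩ := Roumieu.exists_isSlowing ω ω₁
  refine ⟨⟨_, .mk _ (Roumieu.isModerate_slowedNet a hφ.1 hω₁ hη), hdirac,
    ⟨_, _, rfl, Roumieu.isRegularNet_slowedNet a hφ.1 hω₁ hη⟩,
    (Roumieu.netStronglyAssociated_slowedNet hφ hω₁ hη a).stronglyAssociated _⟩,
    hdirac, ⟨φ, hφ⟩, ⟨ω₁, hω₁⟩, fun φ hφ ω₁ hω₁ => ⟨Roumieu.exists_isSlowing ω ω₁,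
      fun η hη => ⟨Roumieu.isModerate_slowedNet a hφ.1 hω₁ hη,
        ⟨_, _, rfl, Roumieu.isRegularNet_slowedNet a hφ.1 hω₁ hη⟩,
        ⟨_, _, rfl, Roumieu.isRegularNetProj_slowedNet a hφ.1 hω₁ hη⟩,
        (Roumieu.netStronglyAssociated_slowedNet hφ hω₁ hη a).stronglyAssociated _⟩⟩⟩
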